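/- Words are over the alphabet $A=\{0,1\}$. A right ideal of $A^*$ is a set $R\subseteq A^*$ with $RA^*\subseteq R$. It is essential if it meets every non-empty right ideal, and $R'$ is essential in $R$ if $R'$ meets every right ideal that $R$ meets. A right-ideal homomorphism is a map $\varphi:R_1\to A^*$ on a finitely generated (possibly empty) right ideal $R_1$ with $\varphi(xz)=\varphi(x)z$ for all $x\in R_1$, $z\in A^*$. An extension of $\varphi$ to a right-ideal homomorphism $\Phi$ is called essential if the domain of $\varphi$ is essential in that of $\Phi$; every $\varphi$ has a unique maximum essential extension $\max(\varphi)$, and we say that $\varphi$ represents $\max(\varphi)$. The Thompson–Higman monoid $M_{2,1}$ is the set of all $\max(\varphi)$, with multiplication $\varphi\cdot\psi=\max(\varphi\circ\psi)$. The submonoid ${\it lep}M_{2,1}$ consists of the elements represented by some right-ideal homomorphism $\varphi$ with essential domain such that $|x_1|=|x_2|$ implies $|\varphi(x_1)|=|\varphi(x_2)|$ for all $x_1,x_2\in{\rm Dom}(\varphi)$. The group ${\it lp}G_{2,1}\subseteq M_{2,1}$ consists of the maximally extended isomorphisms $\varphi$ between finitely generated essential right ideals with $|\varphi(x)|=|x|$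 for all $x\in{\rm Dom}(\varphi)$. For $1\le i<j$, $\tau_{i,j}\in{\it lep}M_{2,1}$ is the element that exchanges the $i$-th and the $j$-th letter of every word of length at least $j$; let $\tau=\{\tau_{i,j}:1\le i<j\}$. For a generating set $\Gamma$ of a monoid $M$, $|m|_\Gamma$ is the smallest length of a word over $\Gamma$ with product $m$. For a group $G\subseteq M$, the word-length asymmetry function of $G$ within $M$ over $\Gamma$ is $\lambda(n)=\max\{|g^{-1}|_\Gamma : g\in G,\ |g|_\Gamma\le n\}$ for $n\in\mathbb N$. Let $\Gamma_{M}$ be a finite generating set of $M_{2,1}$, and let $\Gamma_{\it lep}$ be a finite set such that $\Gamma_{\it lep}\cup\tau$ generates ${\it lep}M_{2,1}$. Let $\lambda_{M}$ be the word-length asymmetry function of ${\it lp}G_{2,1}$ within $M_{2,1}$ over $\Gamma_{M}\cup\tau$, and $\lambda_{\it lep}$ that of ${\it lp}G_{2,1}$ within ${\it lep}M_{2,1}$ over $\Gamma_{\it lep}\cup\tau$. **Proposition.** The maxima defining $\lambda_M(n)$ and $\lambda_{\it lep}(n)$ exist for every $n\in\mathbb N$. The functions $\lambda_M$ and $\lambda_{\it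 lep}$ are polynomially equivalent, i.e. there are positive integers $c_0,c_1,c_2,d,e$ such that for all $n\ge c_0$: $\lambda_M(n)\le c_1\,\lambda_{\it lep}(c_1n^d)^d$ and $\lambda_{\it lep}(n)\le c_2\,\lambda_M(c_2n^e)^e$. More precisely, there are positive integers $c_0,c_1,c_0',c_1'$ such that for all $n\in\mathbb N$: $$\lambda_M(n)\le c_0\,\lambda_{\it lep}(c_1n^2),\qquad \lambda_{\it lep}(n)\le c_0'\,\big(\lambda_M(c_1'n)\big)^2 .$$ -/

import Mathlib

namespace Thompson

/-- Finite words over the alphabet `{0,1}`. -/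
abbrev Word : Type := List Bool

/-- Right ideals of the free monoid `{0,1}^*`. -/
def IsRightIdeal (R : Set Word) : Prop := ∀ x ∈ R, ∀ z : Word, x ++ z ∈ R

/-- The right ideal `C {0,1}^*` generated by `C`. -/
def rightIdealOf (C : Set Word) : Set Word := {w | ∃ c ∈ C, ∃ z : Word, w = c ++ z}

/-- A finitely generated right ideal. -/
def IsFG (R : Set Word) : Prop := ∃ C : Set Word, C.Finite ∧ R = rightIdealOf C

/-- A right ideal is essential if it meets every (nonempty) right ideal. -/
def Essential (R : Set Word) : Prop :=
  ∀ I : Set Word, IsRightIdeal I → I.Nonempty → (I ∩ R).Nonempty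

/-- `R'` is essential in `R` if `R'` meets every right ideal that `R` meets. -/
def EssentialIn (R' R : Set Word) : Prop :=
  ∀ I : Set Word, IsRightIdeal I → (I ∩ R).Nonempty → (I ∩ R').Nonempty

/-- A homomorphism between finitely generated right ideals of `{0,1}^*`, as a partial function
(`none` means undefined); the empty partial function is included. -/
@[ext]
structure RIHom where
  toFun : Word → Option Word
  map_append : ∀ x y z : Word, toFun x = some y → toFun (x ++ z) = some (y ++ z)
  fg : IsFG {x | ∃ y, toFun x = some y}

namespace RIHom

def dom (f : RIHom) : Set Word := {x | ∃ y, f.toFun x = some y}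

def im (f : RIHom) : Set Word := {y | ∃ x, f.toFun x = some y}

/-- `f` is an essential restriction of `g`
(equivalently, `g` is an essential extension of `f`). -/
def EssRestr (f g : RIHom) : Prop :=
  (∀ x y, f.toFun x = some y → g.toFun x = some y) ∧ EssentialIn f.dom g.dom

/-- `f` has no proper essential extension. -/
def IsMax (f : RIHom) : Prop := ∀ g : RIHom, EssRestr f g → g = f

end RIHom

theorem isRightIdeal_principal (x : Word) : IsRightIdeal {w | ∃ z, w = x ++ z} := by
  rintro _ ⟨z, rfl⟩ t
  exact ⟨z ++ t, by simp⟩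

theorem essential_iff {R : Set Word} : Essential R ↔ ∀ x, ∃ z : Word, x ++ z ∈ R := by
  constructor
  · intro h x
    obtain ⟨_, ⟨z, rfl⟩, hw⟩ := h _ (isRightIdeal_principal x) ⟨x, [], by simp⟩
    exact ⟨z, hw⟩
  · rintro h I hI ⟨x, hx⟩
    obtain ⟨z, hz⟩ := h x
    exact ⟨x ++ z, hI x hx z, hz⟩

theorem essentialIn_iff {R' R : Set Word} :
    EssentialIn R' R ↔ ∀ x ∈ R, ∃ z : Word, x ++ z ∈ R' := by
  constructor
  · intro h x hx
    obtain ⟨_, ⟨z, rfl⟩, hw⟩ := h _ (isRightIdeal_principal x) ⟨x, ⟨[], by simp⟩, hx⟩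
    exact ⟨z, hw⟩
  · rintro h I hI ⟨x, hx, hxR⟩
    obtain ⟨z, hz⟩ := h x hxR
    exact ⟨x ++ z, hI x hx z, hz⟩

/-- A right ideal is finitely generated as soon as its members have prefixes of bounded length
in it. -/
theorem isFG_of_bounded {R : Set Word} (hR : IsRightIdeal R) (L : ℕ)
    (h : ∀ x ∈ R, ∃ c ∈ R, c.length ≤ L ∧ ∃ z, x = c ++ z) : IsFG R := by
  refine ⟨{c | c ∈ R ∧ c.length ≤ L}, ?_, ?_⟩
  · exact (List.finite_length_le Bool L).subset (fun c hc => hc.2)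
  · ext x
    constructor
    · intro hx
      obtain ⟨c, hc, hl, z, rfl⟩ := h x hx
      exact ⟨c, ⟨hc, hl⟩, z, rfl⟩
    · rintro ⟨c, hc, z, rfl⟩
      exact hR c hc.1 z

theorem IsFG.bounded {R : Set Word} (h : IsFG R) :
    ∃ L : ℕ, ∀ x ∈ R, ∃ c ∈ R, c.length ≤ L ∧ ∃ z, x = c ++ z := by
  obtain ⟨C, hC, rfl⟩ := h
  obtain ⟨L, hL⟩ := (hC.image List.length).bddAbove
  refine ⟨L, ?_⟩
  rintro x ⟨c, hc, z, rfl⟩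
  exact ⟨c, ⟨c, hc, [], by simp⟩, hL ⟨c, hc, rfl⟩, z, rfl⟩

/-- If `x z = c w` then `x` is a prefix of `c` or `c` is a prefix of `x`. -/
theorem append_cases {x z c w : Word} (h : x ++ z = c ++ w) :
    (∃ t, c = x ++ t) ∨ (∃ t, x = c ++ t) := by
  rcases List.append_eq_append_iff.1 h with ⟨t, h1, _⟩ | ⟨t, h1, _⟩
  · exact Or.inl ⟨t, h1⟩
  · exact Or.inr ⟨t, h1⟩

namespace RIHom

theorem dom_isRightIdeal (f : RIHom) : IsRightIdeal f.dom := by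
  rintro x ⟨y, hy⟩ z
  exact ⟨y ++ z, f.map_append x y z hy⟩

/-- The identity map of `{0,1}^*`. -/
def id : RIHom where
  toFun x := some x
  map_append := by
    intro x y z h
    simp_all
  fg := isFG_of_bounded (fun _ _ z => ⟨_, rfl⟩) 0
    (fun x _ => ⟨[], ⟨[], rfl⟩, by simp, x, by simp⟩)

/-- Composition of partial functions: `(f.comp g)(x) = f(g(x))`. -/
def comp (f g : RIHom) : RIHom where
  toFun x := (g.toFun x).bind f.toFun
  map_append := by
    intro x y z h
    obtain ⟨u, hu, hy⟩ := Option.bind_eq_some_iff.1 h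
    rw [g.map_append x u z hu]
    exact f.map_append u y z hy
  fg := by
    obtain ⟨L, hL⟩ := g.fg.bounded
    obtain ⟨K, hK⟩ := f.fg.bounded
    refine isFG_of_bounded ?_ (L + K) ?_
    · rintro x ⟨y, h⟩ z
      obtain ⟨u, hu, hy⟩ := Option.bind_eq_some_iff.1 h
      exact ⟨y ++ z, Option.bind_eq_some_iff.2
        ⟨u ++ z, g.map_append x u z hu, f.map_append u y z hy⟩⟩
    · rintro x ⟨y, h⟩
      obtain ⟨u, hu, hy⟩ := Option.bind_eq_some_iff.1 h
      obtain ⟨p, ⟨v, hv⟩, hpl, z, rfl⟩ := hL x ⟨u, hu⟩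
      have hu' := g.map_append p v z hv
      rw [hu] at hu'
      obtain rfl : u = v ++ z := Option.some.inj hu'
      obtain ⟨q, ⟨r, hr⟩, hql, w, hw⟩ := hK _ ⟨y, hy⟩
      rcases append_cases hw with ⟨t, rfl⟩ | ⟨t, rfl⟩
      · refine ⟨p ++ t, ⟨r, Option.bind_eq_some_iff.2 ⟨_, g.map_append p v t hv, hr⟩⟩, ?_, w, ?_⟩
        · simp only [List.length_append] at hql ⊢
          omega
        · rw [List.append_assoc] at hw
          rw [List.append_cancel_left hw, List.append_assoc]
      · exact ⟨p, ⟨r ++ t, Option.bind_eq_some_iff.2 ⟨_, hv, f.map_append q r t hr⟩⟩,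
          by omega, z, rfl⟩

theorem comp_eq_some {f g : RIHom} {x y : Word} :
    (f.comp g).toFun x = some y ↔ ∃ u, g.toFun x = some u ∧ f.toFun u = some y :=
  Option.bind_eq_some_iff

/-- The maximum essential extension of `f` takes the value `y` at `x` iff `f` is defined on an
essential part of `x {0,1}^*` and sends `x z` to `y z` whenever it is defined there. -/
def MaxVal (f : RIHom) (x y : Word) : Prop :=
  (∀ z, ∃ z' u, f.toFun (x ++ z ++ z') = some u) ∧ ∀ z u, f.toFun (x ++ z) = some u → u = y ++ z

theorem MaxVal.unique {f : RIHom} {x y y' : Word} (h : f.MaxVal x y) (h' : f.MaxVal x y') :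
    y = y' := by
  obtain ⟨z, u, hu⟩ := h.1 []
  rw [List.append_nil] at hu
  have h1 := h.2 z u hu
  rw [h'.2 z u hu] at h1
  exact (List.append_cancel_right h1).symm

theorem MaxVal.append {f : RIHom} {x y : Word} (h : f.MaxVal x y) (z : Word) :
    f.MaxVal (x ++ z) (y ++ z) := by
  constructor
  · intro t
    obtain ⟨z', u, hu⟩ := h.1 (z ++ t)
    exact ⟨z', u, by simpa using hu⟩
  · intro t u hu
    have := h.2 (z ++ t) u (by simpa using hu)
    simpa using this

theorem MaxVal.of_eq {f : RIHom} {x y : Word} (h : f.toFun x = some y) : f.MaxVal x y := by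
  constructor
  · intro z
    exact ⟨[], _, f.map_append _ _ [] (f.map_append x y z h)⟩
  · intro z u hu
    rw [f.map_append x y z h] at hu
    exact (Option.some.inj hu).symm

open Classical in
/-- The maximum essential extension. -/
noncomputable def max (f : RIHom) : RIHom where
  toFun x := if h : ∃ y, f.MaxVal x y then some h.choose else none
  map_append := by
    intro x y z h
    split_ifs at h with hx
    obtain rfl := Option.some.inj h
    have hz : ∃ y, f.MaxVal (x ++ z) y := ⟨_, hx.choose_spec.append z⟩
    rw [dif_pos hz, hz.choose_spec.unique (hx.choose_spec.append z)]
  fg := by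
    obtain ⟨L, hL⟩ := f.fg.bounded
    have key : {x | ∃ y, (if h : ∃ y, f.MaxVal x y then some h.choose else none) = some y}
        = {x | ∃ y, f.MaxVal x y} := by
      ext x
      by_cases h : ∃ y, f.MaxVal x y
      · simp [h]
      · simp [h]
    rw [key]
    refine isFG_of_bounded ?_ L ?_
    · rintro x ⟨y, h⟩ z
      exact ⟨_, h.append z⟩
    · rintro x ⟨y, h⟩
      obtain ⟨z, u, hu⟩ := h.1 []
      rw [List.append_nil] at hu
      obtain ⟨p, ⟨v, hv⟩, hpl, w, hw⟩ := hL _ ⟨u, hu⟩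
      rcases append_cases hw with ⟨t, rfl⟩ | ⟨t, rfl⟩
      · refine ⟨x, ⟨y, h⟩, ?_, [], by simp⟩
        simp only [List.length_append] at hpl
        omega
      · exact ⟨p, ⟨v, MaxVal.of_eq hv⟩, hpl, t, rfl⟩

theorem max_eq_some {f : RIHom} {x y : Word} : f.max.toFun x = some y ↔ f.MaxVal x y := by
  constructor
  · intro h
    simp only [max] at h
    split_ifs at h with hx
    obtain rfl := Option.some.inj h
    exact hx.choose_spec
  · intro h
    have hx : ∃ y, f.MaxVal x y := ⟨y, h⟩
    simp only [max]
    rw [dif_pos hx, hx.choose_spec.unique h]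

theorem ext_iff' {f g : RIHom} (h : ∀ x y, f.toFun x = some y ↔ g.toFun x = some y) : f = g := by
  ext x : 2
  exact Option.ext (fun y => h x y)

theorem essRestr_iff {f g : RIHom} : EssRestr f g ↔
    (∀ x y, f.toFun x = some y → g.toFun x = some y) ∧
      ∀ x y, g.toFun x = some y → ∃ z, f.toFun (x ++ z) = some (y ++ z) := by
  constructor
  · rintro ⟨h1, h2⟩
    refine ⟨h1, fun x y hxy => ?_⟩
    obtain ⟨z, u, hu⟩ := essentialIn_iff.1 h2 x ⟨y, hxy⟩
    refine ⟨z, ?_⟩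
    rw [hu, ← h1 _ _ hu, g.map_append x y z hxy]
  · rintro ⟨h1, h2⟩
    refine ⟨h1, essentialIn_iff.2 ?_⟩
    rintro x ⟨y, hxy⟩
    obtain ⟨z, hz⟩ := h2 x y hxy
    exact ⟨z, _, hz⟩

theorem essRestr_max (f : RIHom) : EssRestr f f.max := by
  refine essRestr_iff.2 ⟨fun x y h => max_eq_some.2 (MaxVal.of_eq h), fun x y h => ?_⟩
  have hm := max_eq_some.1 h
  obtain ⟨z, u, hu⟩ := hm.1 []
  rw [List.append_nil] at hu
  exact ⟨z, by rw [hu, hm.2 z u hu]⟩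

theorem EssRestr.max_eq {f g : RIHom} (h : EssRestr f g) : f.max = g.max := by
  obtain ⟨h1, h2⟩ := essRestr_iff.1 h
  refine ext_iff' fun x y => ?_
  rw [max_eq_some, max_eq_some]
  constructor
  · rintro ⟨ha, hb⟩
    refine ⟨fun z => ?_, fun z u hu => ?_⟩
    · obtain ⟨z', u, hu⟩ := ha z
      exact ⟨z', u, h1 _ _ hu⟩
    · obtain ⟨t, ht⟩ := h2 _ _ hu
      have := hb (z ++ t) (u ++ t) (by simpa using ht)
      rw [← List.append_assoc] at this
      exact List.append_cancel_right this
  · rintro ⟨ha, hb⟩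
    refine ⟨fun z => ?_, fun z u hu => hb z u (h1 _ _ hu)⟩
    obtain ⟨z', u, hu⟩ := ha z
    obtain ⟨t, ht⟩ := h2 _ _ hu
    exact ⟨z' ++ t, _, by simpa using ht⟩

/-- Every essential extension of `f` is a restriction of `f.max`. -/
theorem EssRestr.le_max {f g : RIHom} (h : EssRestr f g) : EssRestr g f.max := by
  rw [h.max_eq]
  exact essRestr_max g

theorem isMax_max (f : RIHom) : IsMax f.max := by
  intro g hg
  have h1 : f.max.max = f.max := (essRestr_max f).max_eq.symm
  have h2 : EssRestr g f.max := by
    have := hg.le_max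
    rwa [h1] at this
  refine ext_iff' fun x y => ⟨h2.1 x y, hg.1 x y⟩

theorem IsMax.max_eq {f : RIHom} (h : IsMax f) : f.max = f := h _ (essRestr_max f)

theorem essRestr_comp_left (f g : RIHom) : EssRestr (f.comp g) (f.max.comp g) := by
  refine essRestr_iff.2 ⟨fun x y h => ?_, fun x y h => ?_⟩
  · obtain ⟨u, hu, hy⟩ := comp_eq_some.1 h
    exact comp_eq_some.2 ⟨u, hu, (essRestr_max f).1 _ _ hy⟩
  · obtain ⟨u, hu, hy⟩ := comp_eq_some.1 h
    obtain ⟨z, hz⟩ := (essRestr_iff.1 (essRestr_max f)).2 _ _ hy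
    exact ⟨z, comp_eq_some.2 ⟨u ++ z, g.map_append _ _ z hu, hz⟩⟩

theorem essRestr_comp_right (f g : RIHom) : EssRestr (f.comp g) (f.comp g.max) := by
  refine essRestr_iff.2 ⟨fun x y h => ?_, fun x y h => ?_⟩
  · obtain ⟨u, hu, hy⟩ := comp_eq_some.1 h
    exact comp_eq_some.2 ⟨u, (essRestr_max g).1 _ _ hu, hy⟩
  · obtain ⟨u, hu, hy⟩ := comp_eq_some.1 h
    obtain ⟨z, hz⟩ := (essRestr_iff.1 (essRestr_max g)).2 _ _ hu
    exact ⟨z, comp_eq_some.2 ⟨u ++ z, hz, f.map_append _ _ z hy⟩⟩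

theorem max_comp_max_left (f g : RIHom) : (f.max.comp g).max = (f.comp g).max :=
  (essRestr_comp_left f g).max_eq.symm

theorem max_comp_max_right (f g : RIHom) : (f.comp g.max).max = (f.comp g).max :=
  (essRestr_comp_right f g).max_eq.symm

theorem comp_assoc (f g h : RIHom) : (f.comp g).comp h = f.comp (g.comp h) := by
  ext x : 2
  exact (Option.bind_assoc _ _ _).symm

theorem comp_id (f : RIHom) : f.comp id = f := rfl

theorem id_comp (f : RIHom) : id.comp f = f := by
  ext x : 2
  change (f.toFun x).bind some = f.toFun x
  cases f.toFun x <;> rfl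

end RIHom

open RIHom

/-- The Thompson–Higman monoid `M_{2,1}`: all maximally extended homomorphisms between finitely
generated right ideals of `{0,1}^*`, multiplied by composition (`f * g` is `f` after `g`)
followed by maximum essential extension. -/
def M21 : Type := {f : RIHom // IsMax f}

namespace M21

/-- The element of `M_{2,1}` represented by a right-ideal homomorphism. -/
noncomputable def mk (f : RIHom) : M21 := ⟨f.max, isMax_max f⟩

theorem mk_val (a : M21) : mk a.1 = a := Subtype.ext a.2.max_eq

noncomputable instance : Monoid M21 where
  mul a b := mk (a.1.comp b.1)
  one := mk RIHom.id
  mul_assoc a b c := by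
    refine Subtype.ext ?_
    change ((a.1.comp b.1).max.comp c.1).max = (a.1.comp (b.1.comp c.1).max).max
    rw [max_comp_max_left, max_comp_max_right, comp_assoc]
  one_mul a := by
    refine Subtype.ext ?_
    change (RIHom.id.max.comp a.1).max = a.1
    rw [max_comp_max_left, id_comp, a.2.max_eq]
  mul_one a := by
    refine Subtype.ext ?_
    change (a.1.comp RIHom.id.max).max = a.1
    rw [max_comp_max_right, comp_id, a.2.max_eq]

theorem mul_val (a b : M21) : (a * b).1 = (a.1.comp b.1).max := rfl

theorem one_val : (1 : M21).1 = RIHom.id.max := rfl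

theorem mk_mul_mk (f g : RIHom) : mk f * mk g = mk (f.comp g) := by
  refine Subtype.ext ?_
  change (f.max.comp g.max).max = (f.comp g).max
  rw [max_comp_max_left, max_comp_max_right]

end M21

/-- `f` maps words of equal length to words of equal length. -/
def LengthEqualityPreserving (f : RIHom) : Prop :=
  ∀ x₁ x₂ y₁ y₂ : Word, f.toFun x₁ = some y₁ → f.toFun x₂ = some y₂ →
    x₁.length = x₂.length → y₁.length = y₂.length

/-- The submonoid `lepM_{2,1}`: the elements represented by some length-equality preserving
right-ideal homomorphism with essential domain (that is, with domain `P {0,1}^*` for a finite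
maximal prefix code `P`). -/
noncomputable def lepM21 : Submonoid M21 where
  carrier := {a | ∃ f : RIHom, Essential f.dom ∧ LengthEqualityPreserving f ∧ M21.mk f = a}
  one_mem' := by
    refine ⟨RIHom.id, essential_iff.2 fun x => ⟨[], _, rfl⟩, ?_, rfl⟩
    intro x₁ x₂ y₁ y₂ h₁ h₂ h
    obtain rfl := Option.some.inj h₁
    obtain rfl := Option.some.inj h₂
    exact h
  mul_mem' := by
    rintro _ _ ⟨f, hf, hf', rfl⟩ ⟨g, hg, hg', rfl⟩
    refine ⟨f.comp g, essential_iff.2 fun x => ?_, ?_, (M21.mk_mul_mk f g).symm⟩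
    · obtain ⟨z, u, hu⟩ := essential_iff.1 hg x
      obtain ⟨w, v, hv⟩ := essential_iff.1 hf u
      refine ⟨z ++ w, v, comp_eq_some.2 ⟨u ++ w, ?_, hv⟩⟩
      rw [← List.append_assoc]
      exact g.map_append _ _ w hu
    · intro x₁ x₂ y₁ y₂ h₁ h₂ h
      obtain ⟨u₁, hu₁, hy₁⟩ := comp_eq_some.1 h₁
      obtain ⟨u₂, hu₂, hy₂⟩ := comp_eq_some.1 h₂
      exact hf' _ _ _ _ hy₁ hy₂ (hg' _ _ _ _ hu₁ hu₂ h)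

/-- `f` is an isomorphism between (finitely generated) essential right ideals. -/
def IsEssentialIso (f : RIHom) : Prop :=
  Essential f.dom ∧ Essential f.im ∧
    ∀ x₁ x₂ y : Word, f.toFun x₁ = some y → f.toFun x₂ = some y → x₁ = x₂

theorem comp_val_eq {a b : M21} (h : a * b = 1) {x y : Word}
    (hxy : (a.1.comp b.1).toFun x = some y) : y = x := by
  have h1 : (a.1.comp b.1).max = RIHom.id.max := congrArg Subtype.val h
  have h2 := (essRestr_max _).1 _ _ hxy
  rw [h1] at h2
  have h3 : RIHom.id.max.toFun x = some x := (essRestr_max _).1 _ _ rfl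
  rw [h3] at h2
  exact (Option.some.inj h2).symm

theorem exists_comp_val {a b : M21} (h : a * b = 1) (x : Word) :
    ∃ z u, b.1.toFun (x ++ z) = some u ∧ a.1.toFun u = some (x ++ z) := by
  have h1 : (a.1.comp b.1).max = RIHom.id.max := congrArg Subtype.val h
  have h3 : RIHom.id.max.toFun x = some x := (essRestr_max _).1 _ _ rfl
  rw [← h1] at h3
  obtain ⟨z, hz⟩ := (essRestr_iff.1 (essRestr_max _)).2 _ _ h3
  obtain ⟨u, hu, hy⟩ := comp_eq_some.1 hz
  exact ⟨z, u, hu, hy⟩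

/-- Every unit of `M_{2,1}` is an isomorphism between essential right ideals. -/
theorem isEssentialIso_unit (u : M21ˣ) : IsEssentialIso u.val.1 := by
  refine ⟨essential_iff.2 fun x => ?_, essential_iff.2 fun y => ?_, fun x₁ x₂ y h₁ h₂ => ?_⟩
  · obtain ⟨z, w, hw, -⟩ := exists_comp_val u.inv_val x
    exact ⟨z, w, hw⟩
  · obtain ⟨z, w, -, hw⟩ := exists_comp_val u.val_inv y
    exact ⟨z, w, hw⟩
  · obtain ⟨z, w, hw, hw'⟩ := exists_comp_val u.inv_val x₁
    have e₁ := u.val.1.map_append _ _ z h₁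
    have e₂ := u.val.1.map_append _ _ z h₂
    rw [hw] at e₁
    obtain rfl := Option.some.inj e₁
    have := comp_val_eq u.inv_val (comp_eq_some.2 ⟨_, e₂, hw'⟩)
    exact List.append_cancel_right this

/-- Conversely, every maximally extended isomorphism between essential right ideals is a unit of
`M_{2,1}`. -/
theorem isUnit_of_isEssentialIso (a : M21) (h : IsEssentialIso a.1) : IsUnit a := by
  classical
  obtain ⟨hd, hi, hinj⟩ := h
  have hval : ∀ x y, (if h : ∃ x, a.1.toFun x = some y then some h.choose else none) = some x ↔
      a.1.toFun x = some y := by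
    intro x y
    constructor
    · intro h
      split_ifs at h with hx
      obtain rfl := Option.some.inj h
      exact hx.choose_spec
    · intro h
      have hx : ∃ x, a.1.toFun x = some y := ⟨x, h⟩
      rw [dif_pos hx, hinj _ _ _ hx.choose_spec h]
  let g : RIHom :=
    { toFun := fun y => if h : ∃ x, a.1.toFun x = some y then some h.choose else none
      map_append := by
        intro y x z h
        exact (hval _ _).2 (a.1.map_append _ _ z ((hval _ _).1 h))
      fg := by
        have key : {y | ∃ x, (if h : ∃ x, a.1.toFun x = some y then some h.choose else none)
            = some x} = a.1.im := by
          ext y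
          exact exists_congr fun x => hval x y
        rw [key]
        obtain ⟨C, hC, hC'⟩ := a.1.fg
        refine ⟨{y | ∃ c ∈ C, a.1.toFun c = some y}, ?_, ?_⟩
        · refine (hC.image fun c => (a.1.toFun c).getD []).subset ?_
          rintro y ⟨c, hc, hy⟩
          exact ⟨c, hc, by simp [hy]⟩
        · ext y
          constructor
          · rintro ⟨x, hx⟩
            have hx' : x ∈ rightIdealOf C := hC' ▸ (⟨y, hx⟩ : x ∈ {x | ∃ y, a.1.toFun x = some y})
            obtain ⟨c, hc, z, rfl⟩ := hx'
            have hcd : c ∈ {x | ∃ y, a.1.toFun x = some y} := by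
              rw [hC']
              exact ⟨c, hc, [], by simp⟩
            obtain ⟨v, hv⟩ := hcd
            refine ⟨v, ⟨c, hc, hv⟩, z, ?_⟩
            rw [a.1.map_append _ _ z hv] at hx
            exact (Option.some.inj hx).symm
          · rintro ⟨v, ⟨c, hc, hv⟩, z, rfl⟩
            exact ⟨c ++ z, a.1.map_append _ _ z hv⟩ }
  have hg : ∀ x y, g.toFun y = some x ↔ a.1.toFun x = some y := hval
  have h1 : a * M21.mk g = 1 := by
    rw [← M21.mk_val a, M21.mk_mul_mk]
    refine Subtype.ext (EssRestr.max_eq (essRestr_iff.2 ⟨fun x y h => ?_, fun x y h => ?_⟩))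
    · obtain ⟨u, hu, hy⟩ := comp_eq_some.1 h
      exact ((hg _ _).1 hu).symm.trans hy
    · obtain rfl := Option.some.inj h
      obtain ⟨z, w, hw⟩ := essential_iff.1 hi x
      exact ⟨z, comp_eq_some.2 ⟨w, (hg _ _).2 hw, hw⟩⟩
  have h2 : M21.mk g * a = 1 := by
    rw [← M21.mk_val a, M21.mk_mul_mk]
    refine Subtype.ext (EssRestr.max_eq (essRestr_iff.2 ⟨fun x y h => ?_, fun x y h => ?_⟩))
    · obtain ⟨u, hu, hy⟩ := comp_eq_some.1 h
      exact congrArg some (hinj _ _ _ hu ((hg _ _).1 hy))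
    · obtain rfl := Option.some.inj h
      obtain ⟨z, w, hw⟩ := essential_iff.1 hd x
      exact ⟨z, comp_eq_some.2 ⟨w, hw, (hg _ _).2 hw⟩⟩
  exact ⟨⟨a, M21.mk g, h1, h2⟩, rfl⟩

/-- `f` preserves length: `|f(x)| = |x|` for all `x` in the domain. -/
def LengthPreserving (f : RIHom) : Prop :=
  ∀ x y : Word, f.toFun x = some y → x.length = y.length

/-- The group `lpG_{2,1}` of length-preserving elements of the Thompson group `G_{2,1}`, inside the
group of units of `M_{2,1}`. The elements of `G_{2,1}` are the maximally extended isomorphisms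
between finitely generated essential right ideals of `{0,1}^*`. -/
def lpG21 : Subgroup M21ˣ where
  carrier := {u | IsEssentialIso u.val.1 ∧ LengthPreserving u.val.1}
  one_mem' := by
    refine ⟨isEssentialIso_unit 1, fun x y h => ?_⟩
    have h3 : RIHom.id.max.toFun x = some x := (essRestr_max _).1 _ _ rfl
    have h4 : RIHom.id.max.toFun x = some y := h
    rw [h3] at h4
    rw [Option.some.inj h4]
  mul_mem' := by
    rintro u v ⟨-, hu⟩ ⟨-, hv⟩
    refine ⟨isEssentialIso_unit _, fun x y h => ?_⟩
    obtain ⟨z, hz⟩ := (essRestr_iff.1 (essRestr_max (u.val.1.comp v.val.1))).2 x y h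
    obtain ⟨w, hw, hy⟩ := comp_eq_some.1 hz
    have := (hv _ _ hw).trans (hu _ _ hy)
    simpa using this
  inv_mem' := by
    rintro u ⟨-, hu⟩
    refine ⟨isEssentialIso_unit _, fun y x h => ?_⟩
    have h' : u.inv.1.toFun y = some x := h
    obtain ⟨z, w, hw, hy⟩ := exists_comp_val u.val_inv y
    rw [u.inv.1.map_append _ _ z h'] at hw
    obtain rfl := Option.some.inj hw
    have := hu _ _ hy
    simpa using this.symm

/-- The map exchanging the letters at the (0-based) positions `i` and `j` of a word, defined on
all words that are long enough. -/
def swapHom (i j : ℕ) : RIHom where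
  toFun x := if i < x.length ∧ j < x.length then
    some ((x.set i (x.getD j false)).set j (x.getD i false)) else none
  map_append := by
    intro x y z h
    split_ifs at h with hx
    obtain rfl := Option.some.inj h
    obtain ⟨hi, hj⟩ := hx
    rw [if_pos (by simp; omega)]
    rw [List.getD_append _ _ _ _ hi, List.getD_append _ _ _ _ hj,
      List.set_append_left _ _ hi, List.set_append_left _ _ (by simpa using hj)]
  fg := by
    refine isFG_of_bounded ?_ (Max.max i j + 1) ?_
    · rintro x ⟨y, h⟩ z
      split_ifs at h with hx
      exact ⟨_, if_pos (by simp; omega)⟩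
    · rintro x ⟨y, h⟩
      split_ifs at h with hx
      refine ⟨x.take (Max.max i j + 1), ⟨_, if_pos ?_⟩, by simp, x.drop (Max.max i j + 1), by simp⟩
      simp
      omega

/-- The bit transpositions `τ_{i,j}`, for all pairs of positions `i < j`, as elements of
`M_{2,1}`. -/
def bitTranspositions : Set M21 := {t | ∃ i j : ℕ, i < j ∧ t = M21.mk (swapHom i j)}

end Thompson

/-- Word-length over `Γ`: the length of a shortest product of elements of `Γ` equal to `m`
(meaningful when `m` lies in the submonoid generated by `Γ`; the identity has length `0`). -/
noncomputable def wordLength {M : Type*} [Monoid M] (Γ : Set M) (m : M) : ℕ :=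
  sInf {k | ∃ l : List M, (∀ γ ∈ l, γ ∈ Γ) ∧ l.prod = m ∧ l.length = k}

/-- The set `{|g⁻¹|_Γ : |g|_Γ ≤ n, g ∈ G}`, for a group `G` of units. -/
def asymmetrySet {M : Type*} [Monoid M] (G : Subgroup Mˣ) (Γ : Set M) (n : ℕ) : Set ℕ :=
  {k | ∃ g ∈ G, wordLength Γ (g : M) ≤ n ∧ wordLength Γ ((g⁻¹ : Mˣ) : M) = k}

/-- The word-length asymmetry function `λ(n) = max {|g⁻¹|_Γ : |g|_Γ ≤ n, g ∈ G}` of `G` within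
the monoid generated by `Γ`. -/
noncomputable def asymmetry {M : Type*} [Monoid M] (G : Subgroup Mˣ) (Γ : Set M) (n : ℕ) : ℕ :=
  sSup (asymmetrySet G Γ n)

/-- Polynomial equivalence of functions `ℕ → ℕ`. -/
def PolyEquiv (f₁ f₂ : ℕ → ℕ) : Prop :=
  ∃ c₀ c₁ c₂ d e : ℕ, 0 < c₀ ∧ 0 < c₁ ∧ 0 < c₂ ∧ 0 < d ∧ 0 < e ∧
    ∀ n ≥ c₀, f₁ n ≤ c₁ * f₂ (c₁ * n ^ d) ^ d ∧ f₂ n ≤ c₂ * f₁ (c₂ * n ^ e) ^ e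

/-! ### Word length in a monoid and change of generators. -/

section WordLength

variable {M : Type*} [Monoid M]

/-! The whole proof compares word lengths of elements of the group over the two generating systems.
Passing from `Γlep ∪ τ` to `ΓM ∪ τ` costs a constant factor (`exists_wordLength_le_mul`). The
converse passage is quadratic (`exists_wordLength_le_and_support`) and is a simulation.

A product of `n` elements of `ΓM ∪ τ` may pass through words whose lengths depend on the input,
which length-equality preserving maps cannot do. So the current word is kept on a tape of fixed
length, flush with its right end, and its varying left end is recorded in unary by a single flag
among `2 N + 1` bits (`conf`). A non-transposition generator rewrites only a bounded prefix
(`RIHom.exists_prefix_bound`), hence `n` factors move the left end by `O(n)`. Each factor is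
performed by trying all `O(n)` offsets in turn (`exists_realizes_loop`); one try is an operation on
boundedly many bits, of cost `O(1)` because transpositions bring any bits to the front
(`exists_realizes_localOp`). This gives `O(n²)`. If the product preserves length, the left end
finally returns to its initial place, where the result can be read off by dropping a fixed prefix.

Since `τ` is infinite, balls need not be finite and the maxima need an argument. The simulation also
bounds, in terms of `n`, the number of positions that the product can change. Such a permutation has
order dividing a factorial determined by that bound (`M21.pow_factorial_eq_one`), so the inverse is
a power with bounded exponent. -/

theorem exists_list_length_eq_wordLength {Γ : Set M} {m : M} (h : m ∈ Submonoid.closure Γ) :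
    ∃ l : List M, (∀ γ ∈ l, γ ∈ Γ) ∧ l.prod = m ∧ l.length = wordLength Γ m := by
  obtain ⟨l, hl, h⟩ := Submonoid.exists_list_of_mem_closure h
  exact Nat.sInf_mem (s := {k | ∃ l : List M, (∀ γ ∈ l, γ ∈ Γ) ∧ l.prod = m ∧ l.length = k})
    ⟨l.length, l, hl, h, rfl⟩

theorem wordLength_prod_le {Γ : Set M} {l : List M} (hl : ∀ γ ∈ l, γ ∈ Γ) :
    wordLength Γ l.prod ≤ l.length :=
  Nat.sInf_le ⟨l, hl, rfl, rfl⟩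

theorem wordLength_one (Γ : Set M) : wordLength Γ (1 : M) = 0 :=
  Nat.le_zero.1 (wordLength_prod_le (Γ := Γ) (l := []) (by simp))

theorem wordLength_le_one_of_mem {Γ : Set M} {γ : M} (h : γ ∈ Γ) : wordLength Γ γ ≤ 1 := by
  simpa using wordLength_prod_le (Γ := Γ) (l := [γ]) (by simpa using h)

theorem wordLength_mul_le {Γ : Set M} {a b : M} (ha : a ∈ Submonoid.closure Γ)
    (hb : b ∈ Submonoid.closure Γ) :
    wordLength Γ (a * b) ≤ wordLength Γ a + wordLength Γ b := by
  obtain ⟨l, hl, rfl, hl'⟩ := exists_list_length_eq_wordLength ha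
  obtain ⟨k, hk, rfl, hk'⟩ := exists_list_length_eq_wordLength hb
  rw [← hl', ← hk', ← List.prod_append, ← List.length_append]
  refine wordLength_prod_le fun γ h => ?_
  rcases List.mem_append.1 h with h | h
  exacts [hl _ h, hk _ h]

theorem wordLength_pow_le {Γ : Set M} {a : M} (ha : a ∈ Submonoid.closure Γ) (k : ℕ) :
    wordLength Γ (a ^ k) ≤ k * wordLength Γ a := by
  induction k with
  | zero => simp [wordLength_one]
  | succ k ih =>
    rw [pow_succ, Nat.succ_mul]
    exact (wordLength_mul_le (pow_mem ha k) ha).trans (Nat.add_le_add_right ih _)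

/-- Only `Γ` has to be finite: letters of the possibly infinite common part `T` are kept at cost
one, and the letters of `Γ` have a common bound on their cost. -/
theorem exists_wordLength_le_mul {Γ Δ T : Set M} (hΓ : Γ.Finite)
    (h : Γ ⊆ Submonoid.closure (Δ ∪ T)) :
    ∃ C : ℕ, 0 < C ∧ ∀ a ∈ Submonoid.closure (Γ ∪ T),
      wordLength (Δ ∪ T) a ≤ C * wordLength (Γ ∪ T) a := by
  obtain ⟨K, hK⟩ := (hΓ.image (wordLength (Δ ∪ T))).bddAbove
  have key : ∀ l : List M, (∀ γ ∈ l, γ ∈ Γ ∪ T) → l.prod ∈ Submonoid.closure (Δ ∪ T) ∧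
      wordLength (Δ ∪ T) l.prod ≤ (K + 1) * l.length := by
    intro l
    induction l with
    | nil => exact fun _ => ⟨Submonoid.one_mem _, by simp [wordLength_one]⟩
    | cons γ l ih =>
      intro hl
      obtain ⟨ih1, ih2⟩ := ih fun δ hδ => hl δ (List.mem_cons_of_mem _ hδ)
      have hγ : γ ∈ Submonoid.closure (Δ ∪ T) ∧ wordLength (Δ ∪ T) γ ≤ K + 1 := by
        rcases hl γ List.mem_cons_self with hγ | hγ
        · exact ⟨h hγ, (hK ⟨γ, hγ, rfl⟩).trans (Nat.le_succ K)⟩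
        · exact ⟨Submonoid.subset_closure (Or.inr hγ),
            (wordLength_le_one_of_mem (Γ := Δ ∪ T) (Or.inr hγ)).trans (by omega)⟩
      rw [List.prod_cons, List.length_cons]
      refine ⟨mul_mem hγ.1 ih1, (wordLength_mul_le hγ.1 ih1).trans ?_⟩
      rw [Nat.mul_succ]
      omega
  refine ⟨K + 1, K.succ_pos, fun a ha => ?_⟩
  obtain ⟨l, hl, rfl, hl'⟩ := exists_list_length_eq_wordLength ha
  rw [← hl']
  exact (key l hl).2

end WordLength

/-! ### Elements of the monoid evaluated on long words. -/

namespace Thompson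

open RIHom

/-- Some extension of `x` lies in `R` and so has a short prefix in `R`; if `x` is at least as long
as that prefix, the prefix is already one of `x`. -/
theorem Essential.exists_length {R : Set Word} (h : Essential R) (hR : IsRightIdeal R)
    (hfg : IsFG R) : ∃ L : ℕ, ∀ x : Word, L ≤ x.length → x ∈ R := by
  obtain ⟨L, hL⟩ := hfg.bounded
  refine ⟨L, fun x hx => ?_⟩
  obtain ⟨z, hz⟩ := essential_iff.1 h x
  obtain ⟨c, hc, hcl, w, hw⟩ := hL _ hz
  rcases append_cases hw with ⟨t, rfl⟩ | ⟨t, rfl⟩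
  · rw [List.length_append] at hcl
    obtain rfl : t = [] := List.length_eq_zero_iff.1 (by omega)
    simpa using hc
  · exact hR c hc t

/-- The restriction of `f` to the words of length at least `m`. -/
def RIHom.restrictLength (f : RIHom) (m : ℕ) : RIHom where
  toFun x := if m ≤ x.length then f.toFun x else none
  map_append := by
    intro x y z h
    split_ifs at h with hx
    rw [if_pos (by simp; omega)]
    exact f.map_append _ _ _ h
  fg := by
    obtain ⟨L, hL⟩ := f.fg.bounded
    refine isFG_of_bounded ?_ (L + m) ?_
    · rintro x ⟨y, h⟩ z
      split_ifs at h with hx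
      exact ⟨y ++ z, by rw [if_pos (by simp; omega)]; exact f.map_append _ _ _ h⟩
    · rintro x ⟨y, h⟩
      split_ifs at h with hx
      obtain ⟨c, ⟨v, hv⟩, hcl, z, rfl⟩ := hL x ⟨y, h⟩
      refine ⟨(c ++ z).take (c.length + m), ⟨v ++ z.take m, ?_⟩, ?_,
        (c ++ z).drop (c.length + m), (List.take_append_drop _ _).symm⟩
      · rw [if_pos (by simp at hx ⊢; omega)]
        rw [List.take_length_add_append]
        exact f.map_append _ _ _ hv
      · simp
        omega

theorem RIHom.essRestr_restrictLength (f : RIHom) (m : ℕ) : EssRestr (f.restrictLength m) f := by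
  refine essRestr_iff.2 ⟨fun x y hxy => ?_, fun x y hxy => ?_⟩
  · simp only [restrictLength] at hxy
    split_ifs at hxy
    exact hxy
  · refine ⟨List.replicate m false, ?_⟩
    simp only [restrictLength]
    rw [if_pos (by simp)]
    exact f.map_append _ _ _ hxy

/-- Two elements of `M_{2,1}` that are defined and agree on all words of length `m` are equal. -/
theorem M21.eq_of_forall_length {a b : M21} (m : ℕ)
    (h : ∀ x : Word, x.length = m → ∃ y, a.1.toFun x = some y ∧ b.1.toFun x = some y) : a = b := by
  have key : a.1.restrictLength m = b.1.restrictLength m := by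
    ext x : 2
    change (if m ≤ x.length then a.1.toFun x else none) =
      if m ≤ x.length then b.1.toFun x else none
    split_ifs with hx
    · obtain ⟨y, h1, h2⟩ := h (x.take m) (by simpa using hx)
      have e1 := a.1.map_append _ _ (x.drop m) h1
      have e2 := b.1.map_append _ _ (x.drop m) h2
      rw [List.take_append_drop] at e1 e2
      rw [e1, e2]
    · rfl
  have h1 := (a.1.essRestr_restrictLength m).max_eq
  have h2 := (b.1.essRestr_restrictLength m).max_eq
  rw [a.2.max_eq] at h1
  rw [b.2.max_eq] at h2
  exact Subtype.ext (by rw [← h1, ← h2, key])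

theorem M21.mk_apply {f : RIHom} {x y : Word} (h : f.toFun x = some y) :
    (M21.mk f).1.toFun x = some y :=
  (essRestr_max f).1 _ _ h

theorem M21.mul_apply {a b : M21} {x y z : Word} (hb : b.1.toFun x = some y)
    (ha : a.1.toFun y = some z) : (a * b).1.toFun x = some z :=
  (essRestr_max _).1 _ _ (comp_eq_some.2 ⟨y, hb, ha⟩)

theorem M21.one_apply (x : Word) : (1 : M21).1.toFun x = some x :=
  (essRestr_max RIHom.id).1 _ _ rfl

theorem M21.pow_apply {a : M21} {f : Word → Word} {X : Set Word}
    (hf : ∀ x ∈ X, f x ∈ X ∧ a.1.toFun x = some (f x)) (k : ℕ) :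
    ∀ x ∈ X, (a ^ k).1.toFun x = some (f^[k] x) := by
  induction k with
  | zero => exact fun x _ => M21.one_apply x
  | succ k ih =>
    intro x hx
    rw [pow_succ, Function.iterate_succ_apply]
    exact M21.mul_apply (hf x hx).2 (ih _ (hf x hx).1)

/-- The composition of the members of a list, as partial functions. -/
def RIHom.compList : List M21 → RIHom
  | [] => RIHom.id
  | γ :: l => γ.1.comp (RIHom.compList l)

theorem M21.mk_compList (l : List M21) : M21.mk (RIHom.compList l) = l.prod := by
  induction l with
  | nil => rfl
  | cons γ l ih =>
    rw [List.prod_cons, ← ih, RIHom.compList, ← M21.mk_mul_mk, M21.mk_val]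

/-- A product with essential domain is defined, factor by factor, on all long words. -/
theorem exists_length_compList {l : List M21} (h : Essential l.prod.1.dom) :
    ∃ L : ℕ, ∀ x : Word, L ≤ x.length →
      ∃ y, (RIHom.compList l).toFun x = some y ∧ l.prod.1.toFun x = some y := by
  have hl : EssRestr (RIHom.compList l) l.prod.1 := by
    rw [← M21.mk_compList l]
    exact essRestr_max _
  obtain ⟨L, hL⟩ := Essential.exists_length (R := (RIHom.compList l).dom)
    (essential_iff.2 fun x => by
      obtain ⟨z, y, hy⟩ := essential_iff.1 h x
      obtain ⟨w, hw⟩ := (essRestr_iff.1 hl).2 _ _ hy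
      exact ⟨z ++ w, y ++ w, by rwa [← List.append_assoc]⟩)
    (RIHom.compList l).dom_isRightIdeal (RIHom.compList l).fg
  refine ⟨L, fun x hx => ?_⟩
  obtain ⟨y, hy⟩ := hL x hx
  exact ⟨y, hy, hl.1 _ _ hy⟩

end Thompson

/-! ### Bit operations realized by few generators of the length-equality preserving monoid. -/

namespace Thompson

open RIHom

/-- The word of length `T` with letters `s 0, …, s (T - 1)`. -/
def bits (T : ℕ) (s : ℕ → Bool) : Word := (List.range T).map s

@[simp]
theorem length_bits (T : ℕ) (s : ℕ → Bool) : (bits T s).length = T := by simp [bits]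

theorem getD_bits {T t : ℕ} (s : ℕ → Bool) (h : t < T) : (bits T s).getD t false = s t := by
  simp [bits, h]

theorem bits_congr {T : ℕ} {s s' : ℕ → Bool} (h : ∀ t < T, s t = s' t) : bits T s = bits T s' :=
  List.map_congr_left fun t ht => h t (List.mem_range.1 ht)

theorem bits_getD (x : Word) : bits x.length (fun t => x.getD t false) = x := by
  refine List.ext_getElem (by simp) fun i h1 h2 => ?_
  simp [bits, h2]

theorem bits_add (a b : ℕ) (s : ℕ → Bool) :
    bits (a + b) s = bits a s ++ bits b fun t => s (a + t) := by
  simp [bits, List.range_add, Function.comp_def]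

/-- The map replacing the prefix `r` of length `d` of a word by `φ r`. -/
def prefixHom (d : ℕ) (φ : Word → Word) : RIHom where
  toFun x := if d ≤ x.length then some (φ (x.take d) ++ x.drop d) else none
  map_append := by
    intro x y z h
    split_ifs at h with hx
    obtain rfl := Option.some.inj h
    rw [if_pos (by simp; omega), List.take_append_of_le_length hx,
      List.drop_append_of_le_length hx, List.append_assoc]
  fg := by
    refine isFG_of_bounded ?_ d ?_
    · rintro x ⟨y, h⟩ z
      split_ifs at h with hx
      exact ⟨_, if_pos (by simp; omega)⟩
    · rintro x ⟨y, h⟩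
      split_ifs at h with hx
      exact ⟨x.take d, ⟨_, if_pos (by simp; omega)⟩, by simp, x.drop d, by simp⟩

theorem prefixHom_append {d : ℕ} {φ : Word → Word} {x z : Word} (h : x.length = d) :
    (prefixHom d φ).toFun (x ++ z) = some (φ x ++ z) := by
  subst h
  simp [prefixHom]

/-- The change of length is the constant `e - d`. Apart from transpositions, these are the only
elements used to build the simulation. -/
theorem mk_prefixHom_mem {d e : ℕ} {φ : Word → Word} (h : ∀ r, r.length = d → (φ r).length = e) :
    M21.mk (prefixHom d φ) ∈ lepM21 := by
  refine ⟨prefixHom d φ, essential_iff.2 fun x => ⟨List.replicate d false, _, if_pos (by simp)⟩,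
    fun x₁ x₂ y₁ y₂ h₁ h₂ hx => ?_, rfl⟩
  simp only [prefixHom] at h₁ h₂
  split_ifs at h₁ h₂ with hx₁ hx₂
  obtain rfl := Option.some.inj h₁
  obtain rfl := Option.some.inj h₂
  rw [List.length_append, List.length_append, h _ (by simpa using hx₁), h _ (by simpa using hx₂),
    List.length_drop, List.length_drop, hx]

/-- Some element of word-length at most `k` over `Γ` maps `bits T s` to `bits T' (f s)`, for
all `s`. -/
def Realizes (Γ : Set M21) (T T' k : ℕ) (f : (ℕ → Bool) → ℕ → Bool) : Prop :=
  ∃ a ∈ Submonoid.closure Γ, wordLength Γ a ≤ k ∧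
    ∀ s, a.1.toFun (bits T s) = some (bits T' (f s))

namespace Realizes

variable {Γ : Set M21} {T T' T'' k k' : ℕ} {f f' : (ℕ → Bool) → ℕ → Bool}

theorem refl (Γ : Set M21) (T k : ℕ) : Realizes Γ T T k fun s => s :=
  ⟨1, one_mem _, by simp [wordLength_one], fun s => M21.one_apply _⟩

theorem trans (h : Realizes Γ T T' k f) (h' : Realizes Γ T' T'' k' f') :
    Realizes Γ T T'' (k + k') fun s => f' (f s) := by
  obtain ⟨a, ha, hk, hf⟩ := h
  obtain ⟨b, hb, hk', hf'⟩ := h'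
  exact ⟨b * a, mul_mem hb ha, (wordLength_mul_le hb ha).trans (by omega),
    fun s => M21.mul_apply (hf s) (hf' _)⟩

theorem mono (h : Realizes Γ T T' k f) (hk : k ≤ k') : Realizes Γ T T' k' f := by
  obtain ⟨a, ha, hk', hf⟩ := h
  exact ⟨a, ha, hk'.trans hk, hf⟩

theorem congr (h : Realizes Γ T T' k f) (hf : ∀ s, ∀ t < T', f s t = f' s t) :
    Realizes Γ T T' k f' := by
  obtain ⟨a, ha, hk', hf'⟩ := h
  exact ⟨a, ha, hk', fun s => by rw [hf' s, bits_congr (hf s)]⟩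

theorem foldl {α : Type*} (op : α → (ℕ → Bool) → ℕ → Bool) (l : List α)
    (h : ∀ x ∈ l, Realizes Γ T T k (op x)) :
    Realizes Γ T T (k * l.length) fun s => l.foldl (fun s x => op x s) s := by
  induction l with
  | nil => exact refl Γ T _
  | cons x l ih =>
    have := (h x List.mem_cons_self).trans (ih fun y hy => h y (List.mem_cons_of_mem _ hy))
    refine this.mono ?_
    rw [List.length_cons, Nat.mul_succ]
    omega

end Realizes

theorem swapHom_bits {i j T : ℕ} (hi : i < T) (hj : j < T) (s : ℕ → Bool) :
    (swapHom i j).toFun (bits T s) = some (bits T fun t => s (Equiv.swap i j t)) := by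
  simp only [swapHom, length_bits, hi, hj, and_self, if_true, getD_bits]
  congr 1
  refine List.ext_getElem (by simp) fun t h1 h2 => ?_
  simp only [bits, List.getElem_set, List.getElem_map, List.getElem_range, Equiv.swap_apply_def]
  by_cases h3 : j = t
  · subst h3
    by_cases h4 : j = i <;> simp [h4]
  · by_cases h4 : i = t
    · simp [h3, h4]
    · simp [h3, h4, Ne.symm h3, Ne.symm h4]

theorem realizes_swap {Γ : Set M21} (hΓ : bitTranspositions ⊆ Γ) {i j T : ℕ} (hi : i < T)
    (hj : j < T) : Realizes Γ T T 1 fun s t => s (Equiv.swap i j t) := by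
  have key : ∀ {i j : ℕ}, i < j → i < T → j < T →
      Realizes Γ T T 1 fun s t => s (Equiv.swap i j t) := by
    intro i j hij hi hj
    have hm : M21.mk (swapHom i j) ∈ Γ := hΓ ⟨i, j, hij, rfl⟩
    exact ⟨_, Submonoid.subset_closure hm, wordLength_le_one_of_mem hm,
      fun s => M21.mk_apply (swapHom_bits hi hj s)⟩
  rcases lt_trichotomy i j with h | rfl | h
  · exact key h hi hj
  · exact (Realizes.refl Γ T 1).congr fun s t _ => by simp
  · rw [Equiv.swap_comm]
    exact key h hj hi

/-- One transposition per position suffices, at a cost independent of `T` and of the distances: each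
new one sends the current image of `d` to its target and, by injectivity, leaves the earlier targets
alone. The inverse is needed for conjugation. -/
theorem exists_perm_realizes {Γ : Set M21} (hΓ : bitTranspositions ⊆ Γ) {T : ℕ} (d : ℕ)
    (hd : d ≤ T) (π : Fin d → ℕ) (hπ : Function.Injective π) (hπT : ∀ j, π j < T) :
    ∃ σ : Equiv.Perm ℕ, (∀ j : Fin d, σ j = π j) ∧ (∀ t, σ t < T ↔ t < T) ∧
      Realizes Γ T T d (fun s t => s (σ t)) ∧ Realizes Γ T T d fun s t => s (σ.symm t) := by
  induction d with
  | zero => exact ⟨1, fun j => j.elim0, fun t => Iff.rfl, Realizes.refl Γ T 0, Realizes.refl Γ T 0⟩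
  | succ d ih =>
    obtain ⟨σ, h1, h2, h3, h4⟩ := ih (by omega) (fun j => π j.castSucc)
      (fun i j h => Fin.castSucc_injective d (hπ h)) fun j => hπT _
    have hσd : σ d < T := (h2 d).2 (by omega)
    have hsw := realizes_swap hΓ hσd (hπT (Fin.last d))
    refine ⟨σ.trans (Equiv.swap (σ d) (π (Fin.last d))), fun j => ?_, fun t => ?_, ?_, ?_⟩
    · induction j using Fin.lastCases with
      | last => simp
      | cast j =>
        have e1 : σ j = π j.castSucc := h1 j
        have e2 : π j.castSucc ≠ σ d := by
          rw [← e1]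
          intro h
          have := σ.injective h
          omega
        have e3 : π j.castSucc ≠ π (Fin.last d) := fun h => by
          have := congrArg Fin.val (hπ h)
          simp at this
          omega
        simp only [Fin.val_castSucc, Equiv.trans_apply, e1]
        exact Equiv.swap_apply_of_ne_of_ne e2 e3
    · rw [← h2 t, Equiv.trans_apply, Equiv.swap_apply_def]
      split_ifs with h5 h6
      · rw [h5]
        exact iff_of_true (hπT _) hσd
      · rw [h6]
        exact iff_of_true hσd (hπT _)
      · rfl
    · exact (hsw.trans h3).mono (by omega)
    · exact h4.trans hsw

/-- The operation on sequences of bits that applies `φ` to the bits at the positions `π`. -/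
noncomputable def localOp {κ : Type*} (φ : (κ → Bool) → κ → Bool) (π : κ → ℕ)
    (s : ℕ → Bool) : ℕ → Bool :=
  Function.extend π (φ (s ∘ π)) s

theorem localOp_apply {κ : Type*} {φ : (κ → Bool) → κ → Bool} {π : κ → ℕ}
    (hπ : Function.Injective π) (s : ℕ → Bool) (k : κ) :
    localOp φ π s (π k) = φ (s ∘ π) k :=
  hπ.extend_apply _ _ _

theorem localOp_apply_of_forall_ne {κ : Type*} {φ : (κ → Bool) → κ → Bool} {π : κ → ℕ}
    (s : ℕ → Bool) {t : ℕ} (h : ∀ k, π k ≠ t) : localOp φ π s t = s t :=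
  Function.extend_apply' _ _ _ (by simpa using h)

theorem localOp_eq_self {κ : Type*} {φ : (κ → Bool) → κ → Bool} {π : κ → ℕ}
    (hπ : Function.Injective π) {s : ℕ → Bool} (h : φ (s ∘ π) = s ∘ π) : localOp φ π s = s := by
  funext t
  by_cases ht : ∃ k, π k = t
  · obtain ⟨k, rfl⟩ := ht
    rw [localOp_apply hπ, h]
    rfl
  · exact localOp_apply_of_forall_ne s (by simpa using ht)

section Generators

variable {Γ : Set M21} (hΓ : Submonoid.closure (Γ ∪ bitTranspositions) = lepM21)

include hΓ in
theorem exists_realizes_prefix {d e : ℕ} {φ : Word → Word}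
    (h : ∀ r, r.length = d → (φ r).length = e) :
    ∃ K, ∀ t (f : (ℕ → Bool) → ℕ → Bool),
      (∀ s, bits e (f s) = φ (bits d s)) → (∀ s t, f s (e + t) = s (d + t)) →
      Realizes (Γ ∪ bitTranspositions) (d + t) (e + t) K f := by
  -- The constant is the word length of one fixed element, which serves every tail length `t`.
  refine ⟨_, fun t f h1 h2 => ⟨M21.mk (prefixHom d φ), hΓ ▸ mk_prefixHom_mem h, le_rfl, fun s => ?_⟩⟩
  refine M21.mk_apply ?_
  rw [bits_add, bits_add, prefixHom_append (length_bits _ _), h1]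
  simp only [h2]

include hΓ in
-- Bring the chosen bits to the front, apply a fixed prefix map, and bring them back. The bound
-- depends on `φ` but not on where the bits lie.
theorem exists_realizes_localOp {κ : Type*} [Finite κ] (φ : (κ → Bool) → κ → Bool) :
    ∃ K, ∀ T (π : κ → ℕ), Function.Injective π → (∀ k, π k < T) →
      Realizes (Γ ∪ bitTranspositions) T T K (localOp φ π) := by
  classical
  obtain ⟨d, ⟨e⟩⟩ := Finite.exists_equiv_fin κ
  obtain ⟨K, hK⟩ := exists_realizes_prefix hΓ (d := d) (e := d)
    (φ := fun r => bits d fun t => if h : t < d then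
      φ (fun k => r.getD (e k) false) (e.symm ⟨t, h⟩) else false) (by simp)
  refine ⟨d + K + d, fun T π hπ hπT => ?_⟩
  have hdT : d ≤ T := by
    have := Fintype.card_le_of_injective (fun j : Fin d => (⟨π (e.symm j), hπT _⟩ : Fin T))
      fun i j h => e.symm.injective (hπ (congrArg Fin.val h))
    simpa using this
  obtain ⟨σ, h1, h2, h3, h4⟩ := exists_perm_realizes (T := T) (Set.subset_union_right (s := Γ)) d hdT
    (fun j => π (e.symm j)) (hπ.comp e.symm.injective) fun j => hπT _
  obtain ⟨t, rfl⟩ := Nat.exists_eq_add_of_le hdT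
  have h5 := hK t (localOp φ fun k => (e k : ℕ)) (fun s => bits_congr fun t ht => ?_) fun s t => ?_
  · refine ((h3.trans h5).trans h4).congr fun s t ht => ?_
    have hinj : Function.Injective fun k => (e k : ℕ) := Fin.val_injective.comp e.injective
    have hσ : ∀ k, σ (e k) = π k := fun k => by rw [h1]; simp
    by_cases htk : ∃ k, π k = t
    · obtain ⟨k, rfl⟩ := htk
      rw [← hσ k, Equiv.symm_apply_apply, localOp_apply hinj, hσ, localOp_apply hπ]
      simp only [Function.comp_def, hσ]
    · have htk' : ∀ k, π k ≠ t := by simpa using htk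
      rw [localOp_apply_of_forall_ne s htk', localOp_apply_of_forall_ne, Equiv.apply_symm_apply]
      intro k hk
      exact htk' k (by rw [← hσ, hk, Equiv.apply_symm_apply])
  · have hinj : Function.Injective fun k => (e k : ℕ) := Fin.val_injective.comp e.injective
    have := localOp_apply (φ := φ) hinj s (e.symm ⟨t, ht⟩)
    simp only [Equiv.apply_symm_apply] at this
    rw [this, dif_pos ht]
    congr 1
    funext k
    rw [getD_bits _ (e k).2]
    rfl
  · refine localOp_apply_of_forall_ne s fun k => ?_
    have := (e k).2
    omega

include hΓ in
theorem exists_realizes_prepend : ∃ K, ∀ T n,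
    Realizes (Γ ∪ bitTranspositions) T (n + T) (K * n)
      fun s t => if t < n then false else s (t - n) := by
  obtain ⟨K, hK⟩ := exists_realizes_prefix hΓ (d := 0) (e := 1) (φ := fun _ => [false]) (by simp)
  refine ⟨K, fun T n => ?_⟩
  induction n with
  | zero => rw [Nat.zero_add]; exact (Realizes.refl _ T 0).congr (by simp)
  | succ n ih =>
    have h := hK (n + T) (fun s t => if t = 0 then false else s (t - 1))
      (fun s => by simp [bits]) (fun s t => by simp)
    rw [Nat.zero_add] at h
    have h' := ih.trans h
    rw [show n + 1 + T = 1 + (n + T) by omega, Nat.mul_succ]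
    refine h'.congr fun s t _ => ?_
    rcases t with _ | t
    · simp
    · simp

include hΓ in
theorem exists_realizes_drop : ∃ K, ∀ T n,
    Realizes (Γ ∪ bitTranspositions) (n + T) T (K * n) fun s t => s (n + t) := by
  obtain ⟨K, hK⟩ := exists_realizes_prefix hΓ (d := 1) (e := 0) (φ := fun _ => []) (by simp)
  refine ⟨K, fun T n => ?_⟩
  induction n with
  | zero => rw [Nat.zero_add]; exact (Realizes.refl _ T 0).congr (by simp)
  | succ n ih =>
    have h := hK (n + T) (fun s t => s (1 + t)) (fun s => by simp [bits]) (fun s t => by simp)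
    rw [Nat.zero_add] at h
    have h' := h.trans ih
    rw [show n + 1 + T = 1 + (n + T) by omega, Nat.mul_succ, Nat.add_comm (K * n)]
    refine h'.congr fun s t _ => ?_
    exact congrArg s (show 1 + (n + _) = n + 1 + _ by omega)

end Generators

end Thompson

/-! ### Simulation of arbitrary elements on configurations. -/

namespace Thompson

open RIHom

/-- With `L` bounding the generators of the domain and `B` their images, a prefix of length `c ≥ L +
B` contains a domain element, and its image has length at most `B + c ≤ 2 c`. Thus `f` only touches
the first `c` letters and changes the length by at most `c`. -/
theorem RIHom.exists_prefix_bound (f : RIHom) : ∃ c₀, ∀ c ≥ c₀, ∀ r z v : Word, r.length = c →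
    f.toFun (r ++ z) = some v → ∃ q, f.toFun r = some q ∧ v = q ++ z ∧ q.length ≤ 2 * c := by
  obtain ⟨L, hL⟩ := f.fg.bounded
  obtain ⟨B, hB⟩ := ((List.finite_length_le Bool L).image
    fun p => ((f.toFun p).getD []).length).bddAbove
  refine ⟨L + B, fun c hc r z v hr hv => ?_⟩
  obtain ⟨p, ⟨y, hy⟩, hpl, w, hw⟩ := hL _ ⟨v, hv⟩
  have hyB : y.length ≤ B := hB ⟨p, hpl, by simp [hy]⟩
  obtain ⟨t, rfl⟩ : ∃ t, r = p ++ t := by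
    rcases append_cases hw with ⟨t, rfl⟩ | h
    · rw [List.length_append] at hpl
      obtain rfl : t = [] := List.length_eq_zero_iff.1 (by omega)
      exact ⟨[], by simp⟩
    · exact h
  refine ⟨y ++ t, f.map_append _ _ _ hy, ?_, ?_⟩
  · rw [List.append_assoc, f.map_append _ _ _ hy] at hv
    simpa using (Option.some.inj hv).symm
  · rw [List.length_append] at hr ⊢
    omega

theorem localOp_eq {κ : Type*} {φ : (κ → Bool) → κ → Bool} {π : κ → ℕ}
    (hπ : Function.Injective π) {s s' : ℕ → Bool} (h : ∀ k, φ (s ∘ π) k = s' (π k))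
    (h' : ∀ t, (∀ k, π k ≠ t) → s t = s' t) : localOp φ π s = s' := by
  funext t
  by_cases ht : ∃ k, π k = t
  · obtain ⟨k, rfl⟩ := ht
    rw [localOp_apply hπ, h]
  · rw [localOp_apply_of_forall_ne s (by simpa using ht), h' t (by simpa using ht)]

/-- Used for a loop in which exactly one pass acts: the passes before it fix `s`, those after it fix
`s'`. -/
theorem foldl_eq_of_mem {α β : Type*} {op : β → α → α} {l : List β} {b : β} (hb : b ∈ l) {s s' : α}
    (h1 : ∀ x ∈ l, x ≠ b → op x s = s) (h2 : ∀ x ∈ l, op x s' = s') (h3 : op b s = s') :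
    l.foldl (fun s x => op x s) s = s' := by
  induction l with
  | nil => simp at hb
  | cons x l ih =>
    rw [List.foldl_cons]
    by_cases hx : x = b
    · subst hx
      rw [h3]
      have : ∀ l : List β, (∀ x ∈ l, op x s' = s') → l.foldl (fun s x => op x s) s' = s' := by
        intro l
        induction l with
        | nil => exact fun _ => rfl
        | cons y l ih' =>
          intro h
          rw [List.foldl_cons, h y List.mem_cons_self]
          exact ih' fun z hz => h z (List.mem_cons_of_mem _ hz)
      exact this l fun y hy => h2 y (List.mem_cons_of_mem _ hy)
    · rw [h1 x List.mem_cons_self hx]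
      exact ih ((List.mem_cons.1 hb).resolve_left (Ne.symm hx))
        (fun y hy => h1 y (List.mem_cons_of_mem _ hy)) fun y hy => h2 y (List.mem_cons_of_mem _ hy)

/-- A configuration: a control bit `d`, then `2 N + 1` bits of which the one with index `a` is set,
then the sequence `G`. -/
def conf (N : ℕ) (d : Bool) (a : ℕ) (G : ℕ → Bool) : ℕ → Bool := fun t =>
  if t = 0 then d else if t < 2 * N + 2 then decide (t = a + 1) else G (t - (2 * N + 2))

theorem conf_zero (N : ℕ) (d : Bool) (a : ℕ) (G : ℕ → Bool) : conf N d a G 0 = d := rfl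

theorem conf_flag {N t : ℕ} (d : Bool) (a : ℕ) (G : ℕ → Bool) (ht : t ≤ 2 * N) :
    conf N d a G (1 + t) = decide (t = a) := by
  simp only [conf]
  rw [if_neg (by omega), if_pos (by omega)]
  exact decide_eq_decide.2 (by omega)

theorem conf_tape (N : ℕ) (d : Bool) (a : ℕ) (G : ℕ → Bool) (p : ℕ) :
    conf N d a G (2 * N + 2 + p) = G p := by
  simp only [conf]
  rw [if_neg (by omega), if_neg (by omega), Nat.add_sub_cancel_left]

theorem conf_cases (N t : ℕ) :
    t = 0 ∨ (∃ p ≤ 2 * N, t = 1 + p) ∨ ∃ p, t = 2 * N + 2 + p := by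
  by_cases h0 : t = 0
  · exact Or.inl h0
  · by_cases h1 : t < 2 * N + 2
    · exact Or.inr (Or.inl ⟨t - 1, by omega, by omega⟩)
    · exact Or.inr (Or.inr ⟨t - (2 * N + 2), by omega⟩)

/-- The action of `f` on the words `bits ℓ fun i ↦ G (a + i)` with `a + ℓ = N + m` and
`|a - N| ≤ e` is realized by elements of word-length at most `k` acting on configurations. They
change `a` by at most `c`, and change `G` only at `D` places. -/
def Simulates (Γ : Set M21) (N m e c k D : ℕ) (f : RIHom) : Prop :=
  ∃ op, Realizes Γ (2 * N + 2 + (N + m)) (2 * N + 2 + (N + m)) k op ∧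
    ∃ S : Finset ℕ, S.card ≤ D ∧ ∀ a ℓ G v, N ≤ a + e → a ≤ N + e → a + ℓ = N + m →
      f.toFun (bits ℓ fun i => G (a + i)) = some v →
      ∃ a' ℓ' G', op (conf N false a G) = conf N false a' G' ∧ a' ≤ a + c ∧ a ≤ a' + c ∧
        a' + ℓ' = N + m ∧ v = bits ℓ' (fun i => G' (a' + i)) ∧ ∀ p ∉ S, G' p = G p

theorem Simulates.mono {Γ : Set M21} {N m e c k D e' c' k' : ℕ} {f : RIHom}
    (h : Simulates Γ N m e c k D f) (he : e' ≤ e) (hc : c ≤ c') (hk : k ≤ k') :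
    Simulates Γ N m e' c' k' D f := by
  obtain ⟨op, hop, S, hS, h⟩ := h
  refine ⟨op, hop.mono hk, S, hS, fun a ℓ G v ha1 ha2 haℓ hv => ?_⟩
  obtain ⟨a', ℓ', G', h1, h2, h3, h4⟩ := h a ℓ G v (by omega) (by omega) haℓ hv
  exact ⟨a', ℓ', G', h1, by omega, by omega, h4⟩

/-- The tolerance `c * n` suffices for `n + 1` factors, since the drift before any factor comes from
at most `n` earlier ones. Costs, drifts and sets of changed positions add up. -/
theorem simulates_compList {Γ : Set M21} {N m n c k D : ℕ} (l : List M21)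
    (hl : ∀ γ ∈ l, Simulates Γ N m (c * n) c k D γ.1) (hn : l.length ≤ n + 1) :
    Simulates Γ N m 0 (c * l.length) (k * l.length) (D * l.length) (RIHom.compList l) := by
  induction l with
  | nil =>
    refine ⟨fun s => s, Realizes.refl _ _ _, ∅, by simp, ?_⟩
    intro a ℓ G v _ _ h hv
    exact ⟨a, ℓ, G, rfl, by simp, by simp, h, (Option.some.inj hv).symm, fun _ _ => rfl⟩
  | cons γ l ih =>
    rw [List.length_cons] at hn ⊢
    obtain ⟨op, hop, S, hS, h⟩ := ih (fun δ hδ => hl δ (List.mem_cons_of_mem _ hδ)) (by omega)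
    obtain ⟨op', hop', S', hS', h'⟩ := hl γ List.mem_cons_self
    refine ⟨fun s => op' (op s), (hop.trans hop').mono (by rw [Nat.mul_succ]), S ∪ S', ?_, ?_⟩
    · refine (Finset.card_union_le _ _).trans ?_
      rw [Nat.mul_succ]
      omega
    · intro a ℓ G v ha1 ha2 haℓ hv
      obtain ⟨u, hu, hv⟩ := comp_eq_some.1 hv
      obtain ⟨a', ℓ', G', h1, h2, h3, h4, rfl, h6⟩ := h a ℓ G u ha1 ha2 haℓ hu
      have hln : c * l.length ≤ c * n := Nat.mul_le_mul_left c (by omega)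
      obtain ⟨b, ℓ'', G'', k1, k2, k3, k4, rfl, k6⟩ :=
        h' a' ℓ' G' v (by omega) (by omega) h4 hv
      refine ⟨b, ℓ'', G'', (congrArg op' h1).trans k1, ?_, ?_, k4, rfl, fun p hp => ?_⟩
      · rw [Nat.mul_succ]
        omega
      · rw [Nat.mul_succ]
        omega
      · rw [Finset.mem_union, not_or] at hp
        rw [k6 p hp.2, h6 p hp.1]

section Generators

variable {Γ : Set M21} (hΓ : Submonoid.closure (Γ ∪ bitTranspositions) = lepM21)

include hΓ in
-- All offsets are tried one after the other. The pass that fires sets the control bit, which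
-- disables the later passes even if the flag has moved to an offset still to be tried; the bit is
-- then cleared at cost `K₀`.
theorem exists_realizes_loop : ∃ K₀, ∀ (N m B K : ℕ) (op : ℕ → (ℕ → Bool) → ℕ → Bool),
    (∀ β < B, Realizes (Γ ∪ bitTranspositions) (2 * N + 2 + (N + m)) (2 * N + 2 + (N + m)) K
      (op β)) →
    ∃ op', Realizes (Γ ∪ bitTranspositions) (2 * N + 2 + (N + m)) (2 * N + 2 + (N + m))
        (K * B + K₀) op' ∧
      ∀ a G a' G' b, b < B →
        (∀ β < B, β ≠ b → op β (conf N false a G) = conf N false a G) →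
        (∀ β < B, op β (conf N true a' G') = conf N true a' G') →
        op b (conf N false a G) = conf N true a' G' →
        op' (conf N false a G) = conf N false a' G' := by
  obtain ⟨K₀, hK₀⟩ := exists_realizes_localOp hΓ (κ := Unit) fun _ _ => false
  refine ⟨K₀, fun N m B K op hop => ?_⟩
  have h1 := Realizes.foldl op (List.range B) fun β hβ => hop β (List.mem_range.1 hβ)
  rw [List.length_range] at h1
  have hinj : Function.Injective fun _ : Unit => 0 := fun _ _ _ => rfl
  refine ⟨_, h1.trans (hK₀ _ (fun _ => 0) hinj fun _ => by omega), ?_⟩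
  intro a G a' G' b hb h2 h3 h4
  rw [foldl_eq_of_mem (op := op) (List.mem_range.2 hb) (fun β hβ => h2 β (List.mem_range.1 hβ))
    (fun β hβ => h3 β (List.mem_range.1 hβ)) h4]
  refine localOp_eq hinj (fun _ => rfl) fun t ht => ?_
  have : t ≠ 0 := Ne.symm (ht ())
  simp only [conf, if_neg this]

/-- The window of positions used to apply a letter at the offset `β + c`. -/
def window (N c β : ℕ) : Option (Fin (2 * c + 1) ⊕ Fin (2 * c)) → ℕ
  | none => 0
  | some (Sum.inl j) => 1 + (β + j)
  | some (Sum.inr j) => 2 * N + 2 + (β + j)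

theorem window_injective {N c β : ℕ} (h : β + 2 * c ≤ 2 * N) :
    Function.Injective (window N c β) := by
  rintro (_ | ⟨⟨i, hi⟩ | ⟨i, hi⟩⟩) (_ | ⟨⟨j, hj⟩ | ⟨j, hj⟩⟩) hij <;> simp [window] at hij ⊢ <;> omega

/-- The word that `f` assigns to the second half of a window. -/
def windowWord (f : RIHom) (c : ℕ) (w : Option (Fin (2 * c + 1) ⊕ Fin (2 * c)) → Bool) : Word :=
  -- Only `i < c` matters, so the padding `false` is never read; the default `[]` is irrelevant
  -- where `f` is defined.
  (f.toFun (bits c fun i => if h : c + i < 2 * c then w (some (Sum.inr ⟨c + i, h⟩)) else false)).getD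
    []

/-- The action of `f` on a window. -/
def windowOp (f : RIHom) (c : ℕ) (w : Option (Fin (2 * c + 1) ⊕ Fin (2 * c)) → Bool) :
    Option (Fin (2 * c + 1) ⊕ Fin (2 * c)) → Bool :=
  if w none = false ∧ w (some (Sum.inl ⟨c, by omega⟩)) = true then fun
    | none => true
    -- The new prefix is written flush with the right end of the window, so it begins at index `2 *
    -- c` minus its length.
    | some (Sum.inl j) => decide (j + (windowWord f c w).length = 2 * c)
    | some (Sum.inr j) => if 2 * c ≤ j + (windowWord f c w).length then
        (windowWord f c w).getD (j + (windowWord f c w).length - 2 * c) false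
      else w (some (Sum.inr j))
  else w

theorem windowWord_conf (f : RIHom) {N c β : ℕ} (d : Bool) (a : ℕ) (G : ℕ → Bool) :
    windowWord f c (conf N d a G ∘ window N c β) =
      (f.toFun (bits c fun i => G (β + c + i))).getD [] := by
  simp only [windowWord]
  congr 2
  refine bits_congr fun i hi => ?_
  rw [dif_pos (by omega)]
  simp only [Function.comp_apply, window, conf_tape]
  congr 1
  omega

theorem localOp_windowOp_eq_self (f : RIHom) {N c β : ℕ} (h : β + 2 * c ≤ 2 * N) {d : Bool} {a : ℕ}
    {G : ℕ → Bool} (hd : d = true ∨ β + c ≠ a) :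
    localOp (windowOp f c) (window N c β) (conf N d a G) = conf N d a G := by
  refine localOp_eq_self (window_injective h) (if_neg ?_)
  simp only [Function.comp_apply, window, conf_zero]
  rw [conf_flag _ _ _ (by omega)]
  rcases hd with rfl | hd
  · simp
  · simp [hd]

theorem localOp_windowOp (f : RIHom) {N c β : ℕ} (h : β + 2 * c ≤ 2 * N) {G : ℕ → Bool} {q : Word}
    (hq : f.toFun (bits c fun i => G (β + c + i)) = some q) (hqc : q.length ≤ 2 * c) :
    localOp (windowOp f c) (window N c β) (conf N false (β + c) G) =
      conf N true (β + (2 * c - q.length)) fun p =>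
        if β + 2 * c ≤ p + q.length ∧ p < β + 2 * c then
          q.getD (p + q.length - (β + 2 * c)) false else G p := by
  have hcond : (conf N false (β + c) G ∘ window N c β) none = false ∧
      (conf N false (β + c) G ∘ window N c β) (some (Sum.inl ⟨c, by omega⟩)) = true := by
    simp only [Function.comp_apply, window, conf_zero]
    rw [conf_flag _ _ _ (by omega)]
    simp
  have hw : windowWord f c (conf N false (β + c) G ∘ window N c β) = q := by
    rw [windowWord_conf, hq]
    rfl
  refine localOp_eq (window_injective h) ?_ ?_
  · simp only [windowOp]
    rw [if_pos hcond]
    rintro (_ | ⟨⟨j, hj⟩ | ⟨j, hj⟩⟩)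
    · rfl
    · simp only [hw, window]
      rw [conf_flag _ _ _ (by omega)]
      exact decide_eq_decide.2 (by omega)
    · simp only [hw, window, conf_tape, Function.comp_apply]
      by_cases h1 : 2 * c ≤ j + q.length
      · rw [if_pos h1, if_pos (by omega)]
        congr 1
        omega
      · rw [if_neg h1, if_neg (by omega)]
  · intro t ht
    rcases conf_cases N t with rfl | ⟨p, hp, rfl⟩ | ⟨p, rfl⟩
    · exact absurd rfl (ht none)
    · rw [conf_flag _ _ _ hp, conf_flag _ _ _ hp]
      have hp' : ¬ (β ≤ p ∧ p < β + (2 * c + 1)) := fun hp' =>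
        ht (some (Sum.inl ⟨p - β, by omega⟩)) (by simp only [window]; omega)
      exact decide_eq_decide.2 (by omega)
    · rw [conf_tape, conf_tape]
      have hp' : ¬ (β ≤ p ∧ p < β + 2 * c) := fun hp' =>
        ht (some (Sum.inr ⟨p - β, by omega⟩)) (by simp only [window]; omega)
      rw [if_neg (by omega)]

include hΓ in
-- A left end within `N - c` of `N` has room for the window reaching `c` places to either side, and
-- `N + c ≤ m` guarantees at least `c` letters to rewrite.
theorem exists_simulates (f : RIHom) : ∃ c₀, ∀ c ≥ c₀, ∃ K, ∀ N m, c ≤ N → N + c ≤ m →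
    Simulates (Γ ∪ bitTranspositions) N m (N - c) c (K * (N + 1)) (4 * N + 2) f := by
  obtain ⟨c₀, hc₀⟩ := f.exists_prefix_bound
  refine ⟨c₀, fun c hc => ?_⟩
  obtain ⟨K₀, hK₀⟩ := exists_realizes_loop hΓ
  obtain ⟨K, hK⟩ := exists_realizes_localOp hΓ (windowOp f c)
  refine ⟨2 * K + K₀, fun N m hcN hm => ?_⟩
  -- The pass `β` serves the left end `a = β + c`, and `a` ranges over `c, …, 2 N - c`. All windows
  -- lie in the first `2 N` tape cells, hence the set of changed positions below.
  obtain ⟨op, h1, h2⟩ := hK₀ N m (2 * N - 2 * c + 1) K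
    (fun β => localOp (windowOp f c) (window N c β)) fun β hβ =>
      hK _ _ (window_injective (by omega)) (by
        rintro (_ | ⟨⟨j, hj⟩ | ⟨j, hj⟩⟩) <;> simp only [window] <;> omega)
  refine ⟨op, h1.mono ?_, Finset.range (2 * N), by simp; omega, ?_⟩
  · have e1 : K * (2 * N - 2 * c + 1) ≤ K * (2 * (N + 1)) := Nat.mul_le_mul_left K (by omega)
    have e2 : K₀ * 1 ≤ K₀ * (N + 1) := Nat.mul_le_mul_left K₀ (by omega)
    nlinarith
  · intro a ℓ G v ha1 ha2 haℓ hv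
    obtain ⟨β, rfl⟩ : ∃ β, a = β + c := ⟨a - c, by omega⟩
    obtain ⟨z, rfl⟩ : ∃ z, ℓ = c + z := ⟨ℓ - c, by omega⟩
    rw [bits_add] at hv
    obtain ⟨q, hq, rfl, hqc⟩ := hc₀ c hc _ _ _ (length_bits _ _) hv
    refine ⟨β + (2 * c - q.length), q.length + z, _, h2 _ _ _ _ β (by omega)
      (fun b hb hne => localOp_windowOp_eq_self f (by omega) (Or.inr (by omega)))
      (fun b hb => localOp_windowOp_eq_self f (by omega) (Or.inl rfl))
      (localOp_windowOp f (by omega) hq hqc), by omega, by omega, by omega, ?_, ?_⟩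
    · rw [bits_add]
      congr 1
      · conv_lhs => rw [← bits_getD q]
        refine bits_congr fun t ht => ?_
        rw [if_pos (by omega)]
        congr 1
        omega
      · refine bits_congr fun t ht => ?_
        rw [if_neg (by omega)]
        congr 1
        omega
    · intro p hp
      rw [Finset.mem_range] at hp
      rw [if_neg (by omega)]

/-- The positions used to exchange the `i`-th and `j`-th letter at the offset `α`. -/
def swapWindow (N i j α : ℕ) : Option (Option Bool) → ℕ
  | none => 0
  | some none => 1 + α
  | some (some b) => 2 * N + 2 + (α + bif b then j else i)

/-- The controlled exchange of two bits. -/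
def swapWindowOp (w : Option (Option Bool) → Bool) : Option (Option Bool) → Bool :=
  if w none = false ∧ w (some none) = true then fun
    | none => true
    | some none => true
    | some (some b) => w (some (some !b))
  else w

theorem swapWindow_injective {N i j α : ℕ} (hij : i < j) (h : α ≤ 2 * N) :
    Function.Injective (swapWindow N i j α) := by
  rintro (_ | _ | _ | _) (_ | _ | _ | _) hij <;> simp [swapWindow] at hij ⊢ <;> omega

theorem localOp_swapWindowOp_eq_self {N i j α : ℕ} (hij : i < j) (h : α ≤ 2 * N) {d : Bool} {a : ℕ}
    {G : ℕ → Bool} (hd : d = true ∨ α ≠ a) :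
    localOp swapWindowOp (swapWindow N i j α) (conf N d a G) = conf N d a G := by
  refine localOp_eq_self (swapWindow_injective hij h) (if_neg ?_)
  simp only [Function.comp_apply, swapWindow, conf_zero]
  rw [conf_flag _ _ _ h]
  rcases hd with rfl | hd
  · simp
  · simp [hd]

theorem localOp_swapWindowOp {N i j α : ℕ} (hij : i < j) (h : α ≤ 2 * N) (G : ℕ → Bool) :
    localOp swapWindowOp (swapWindow N i j α) (conf N false α G) =
      conf N true α fun p => G (Equiv.swap (α + i) (α + j) p) := by
  have hcond : (conf N false α G ∘ swapWindow N i j α) none = false ∧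
      (conf N false α G ∘ swapWindow N i j α) (some none) = true := by
    simp only [Function.comp_apply, swapWindow, conf_zero]
    rw [conf_flag _ _ _ h]
    simp
  refine localOp_eq (swapWindow_injective hij h) ?_ ?_
  · simp only [swapWindowOp]
    rw [if_pos hcond]
    rintro (_ | _ | _ | _)
    · rfl
    · simp only [swapWindow]
      rw [conf_flag _ _ _ h]
      simp
    · simp [swapWindow, conf_tape]
    · simp [swapWindow, conf_tape]
  · intro t ht
    rcases conf_cases N t with rfl | ⟨p, hp, rfl⟩ | ⟨p, rfl⟩
    · exact absurd rfl (ht none)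
    · rw [conf_flag _ _ _ hp, conf_flag _ _ _ hp]
    · rw [conf_tape, conf_tape, Equiv.swap_apply_of_ne_of_ne]
      · rintro rfl
        exact ht (some (some false)) rfl
      · rintro rfl
        exact ht (some (some true)) rfl

include hΓ in
-- The constant is uniform over all transpositions because a local operation costs the same wherever
-- its bits lie. The cells affected are `a + i` and `a + j` for the `2 N + 1` values of `a`, whence
-- `4 N + 2`; the left end never moves.
theorem exists_simulates_swap : ∃ K, ∀ N m i j, i < j → N + j < m →
    Simulates (Γ ∪ bitTranspositions) N m N 0 (K * (N + 1)) (4 * N + 2)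
      (M21.mk (swapHom i j)).1 := by
  obtain ⟨K₀, hK₀⟩ := exists_realizes_loop hΓ
  obtain ⟨K, hK⟩ := exists_realizes_localOp hΓ swapWindowOp
  refine ⟨2 * K + K₀, fun N m i j hij hm => ?_⟩
  obtain ⟨op, h1, h2⟩ := hK₀ N m (2 * N + 1) K
    (fun α => localOp swapWindowOp (swapWindow N i j α)) fun α hα =>
      hK _ _ (swapWindow_injective hij (by omega)) (by
        rintro (_ | _ | _ | _) <;> simp [swapWindow] <;> omega)
  refine ⟨op, h1.mono ?_, (Finset.range (2 * N + 1)).image (· + i) ∪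
    (Finset.range (2 * N + 1)).image (· + j), ?_, ?_⟩
  · have e1 : K * (2 * N + 1) ≤ K * (2 * (N + 1)) := Nat.mul_le_mul_left K (by omega)
    have e2 : K₀ * 1 ≤ K₀ * (N + 1) := Nat.mul_le_mul_left K₀ (by omega)
    nlinarith
  · have e1 := Finset.card_image_le (s := Finset.range (2 * N + 1)) (f := (· + i))
    have e2 := Finset.card_image_le (s := Finset.range (2 * N + 1)) (f := (· + j))
    rw [Finset.card_range] at e1 e2
    refine (Finset.card_union_le _ _).trans ?_
    omega
  · intro a ℓ G v ha1 ha2 haℓ hv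
    refine ⟨a, ℓ, _, h2 _ _ _ _ a (by omega)
      (fun b hb hne => localOp_swapWindowOp_eq_self hij (by omega) (Or.inr hne))
      (fun b hb => localOp_swapWindowOp_eq_self hij (by omega) (Or.inl rfl))
      (localOp_swapWindowOp hij (by omega) G), by omega, by omega, haℓ, ?_, ?_⟩
    · rw [M21.mk_apply (swapHom_bits (by omega) (by omega) _)] at hv
      rw [← Option.some.inj hv]
      refine bits_congr fun t _ => congrArg G ?_
      simp only [Equiv.swap_apply_def]
      split_ifs <;> omega
    · intro p hp
      simp only [Finset.mem_union, Finset.mem_image, Finset.mem_range, not_or, not_exists,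
        not_and] at hp
      exact congrArg G (Equiv.swap_apply_of_ne_of_ne
        (fun h => hp.1 a (by omega) (by omega)) fun h => hp.2 a (by omega) (by omega))

end Generators

end Thompson

/-! ### The quadratic bound, bounded support, and finite order. -/

namespace Thompson

open RIHom

section Generators

variable {Γ : Set M21} (hΓ : Submonoid.closure (Γ ∪ bitTranspositions) = lepM21)

include hΓ in
-- Finiteness of `Δ` gives one `c` and one `K`; for transpositions these are uniform anyway, and
-- only `m₀` depends on the factor. The choice `N = c * (n + 1)` makes the tolerance `N - c` equal
-- to `c * n`.
theorem exists_simulates_of_mem {Δ : Set M21} (hΔ : Δ.Finite) :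
    ∃ c K, ∀ n, ∀ γ ∈ Δ ∪ bitTranspositions, ∃ m₀, ∀ m ≥ m₀,
      Simulates (Γ ∪ bitTranspositions) (c * (n + 1)) m (c * n) c (K * (c * (n + 1) + 1))
        (4 * (c * (n + 1)) + 2) γ.1 := by
  choose c₀ hc₀ using fun γ : M21 => exists_simulates hΓ γ.1
  obtain ⟨c, hc⟩ := (hΔ.image c₀).bddAbove
  -- The threshold is put inside the existential so that `K` can be chosen for every `γ`, with a
  -- dummy value outside the relevant range.
  have : ∀ γ : M21, ∃ K, c ≥ c₀ γ → ∀ N m, c ≤ N → N + c ≤ m →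
      Simulates (Γ ∪ bitTranspositions) N m (N - c) c (K * (N + 1)) (4 * N + 2) γ.1 := by
    intro γ
    by_cases h : c ≥ c₀ γ
    · obtain ⟨K, hK⟩ := hc₀ γ c h
      exact ⟨K, fun _ => hK⟩
    · exact ⟨0, fun h' => absurd h' h⟩
  choose K₀ hK₀ using this
  obtain ⟨K₁, hK₁⟩ := (hΔ.image K₀).bddAbove
  obtain ⟨K₂, hK₂⟩ := exists_simulates_swap hΓ
  refine ⟨c, K₁ + K₂, fun n γ hγ => ?_⟩
  have hcn : c * (n + 1) = c * n + c := Nat.mul_succ c n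
  rcases hγ with hγ | ⟨i, j, hij, rfl⟩
  · refine ⟨c * (n + 1) + c, fun m hm => ?_⟩
    refine (hK₀ γ (hc ⟨γ, hγ, rfl⟩) (c * (n + 1)) m (by omega) hm).mono (by omega) le_rfl ?_
    exact Nat.mul_le_mul_right _ ((hK₁ ⟨γ, hγ, rfl⟩).trans (by omega))
  · refine ⟨c * (n + 1) + j + 1, fun m hm => ?_⟩
    refine (hK₂ (c * (n + 1)) m i j hij (by omega)).mono (by omega) (by omega) ?_
    exact Nat.mul_le_mul_right _ (by omega)

include hΓ in
theorem exists_realizes_init : ∃ K, ∀ N m,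
    Realizes (Γ ∪ bitTranspositions) m (2 * N + 2 + (N + m)) (K * (N + 1)) fun s =>
      conf N false N fun p => if p < N then false else s (p - N) := by
  obtain ⟨K₁, h1⟩ := exists_realizes_prepend hΓ
  obtain ⟨K₂, h2⟩ := exists_realizes_localOp hΓ (κ := Unit) fun _ _ => true
  refine ⟨3 * K₁ + K₂, fun N m => ?_⟩
  -- One control bit, `2 N + 1` flags, and `N` blank tape cells to the left of the word.
  have h := h1 m (3 * N + 2)
  rw [show 3 * N + 2 + m = 2 * N + 2 + (N + m) by omega] at h
  have hinj : Function.Injective fun _ : Unit => 1 + N := fun _ _ _ => rfl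
  refine ((h.trans (h2 _ (fun _ => 1 + N) hinj fun _ => by omega)).mono ?_).congr
    fun s t _ => congrFun ?_ t
  · have e1 : K₁ * (3 * N + 2) ≤ K₁ * (3 * (N + 1)) := Nat.mul_le_mul_left K₁ (by omega)
    have e2 : K₂ * 1 ≤ K₂ * (N + 1) := Nat.mul_le_mul_left K₂ (by omega)
    nlinarith
  · refine localOp_eq hinj (fun _ => ?_) fun t ht => ?_
    · rw [conf_flag _ _ _ (by omega)]
      simp
    · rcases conf_cases N t with rfl | ⟨p, hp, rfl⟩ | ⟨p, rfl⟩
      · rfl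
      · have := ht ()
        rw [if_pos (by omega), conf_flag _ _ _ hp]
        exact (decide_eq_false (by omega)).symm
      · rw [conf_tape]
        by_cases h : p < N
        · rw [if_pos h, if_pos (by omega)]
        · rw [if_neg h, if_neg (by omega)]
          congr 1
          omega

include hΓ in
theorem exists_realizes_final : ∃ K, ∀ N m,
    Realizes (Γ ∪ bitTranspositions) (2 * N + 2 + (N + m)) m (K * (N + 1)) fun s t =>
      s (2 * N + 2 + (N + t)) := by
  obtain ⟨K, hK⟩ := exists_realizes_drop hΓ
  refine ⟨3 * K, fun N m => ?_⟩
  have h := hK m (3 * N + 2)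
  rw [show 3 * N + 2 + m = 2 * N + 2 + (N + m) by omega] at h
  refine (h.mono ?_).congr fun s t _ => congrArg s (by omega)
  have e1 : K * (3 * N + 2) ≤ K * (3 * (N + 1)) := Nat.mul_le_mul_left K (by omega)
  nlinarith

theorem exists_forall_of_mem_list {α : Type*} {P : α → ℕ → Prop} (l : List α)
    (h : ∀ x ∈ l, ∃ m₀, ∀ m ≥ m₀, P x m) : ∃ m₀, ∀ m ≥ m₀, ∀ x ∈ l, P x m := by
  induction l with
  | nil => exact ⟨0, by simp⟩
  | cons x l ih =>
    obtain ⟨a, ha⟩ := h x List.mem_cons_self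
    obtain ⟨b, hb⟩ := ih fun y hy => h y (List.mem_cons_of_mem _ hy)
    refine ⟨a + b, fun m hm y hy => ?_⟩
    rcases List.mem_cons.1 hy with rfl | hy
    · exact ha m (by omega)
    · exact hb m (by omega) y hy

include hΓ in
/-- A length-preserving product of `n` elements of `Δ ∪ τ` has word-length `O(n²)` over any set of
generators of `lepM_{2,1}`, and there is a bound in terms of `n` on the number of letters that it
changes. -/
theorem exists_wordLength_le_and_support {Δ : Set M21} (hΔ : Δ.Finite) :
    ∃ (C : ℕ) (D : ℕ → ℕ), Monotone D ∧ ∀ l : List M21, (∀ γ ∈ l, γ ∈ Δ ∪ bitTranspositions) →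
      Essential l.prod.1.dom → LengthPreserving l.prod.1 →
      wordLength (Γ ∪ bitTranspositions) l.prod ≤ C * l.length ^ 2 ∧
      ∃ (m : ℕ) (S : Finset ℕ), S.card ≤ D l.length ∧ ∀ x : Word, x.length = m →
        ∃ y : Word, l.prod.1.toFun x = some y ∧ y.length = m ∧
          ∀ i ∉ S, y.getD i false = x.getD i false := by
  obtain ⟨c, K, hcK⟩ := exists_simulates_of_mem hΓ hΔ
  obtain ⟨K₁, hK₁⟩ := exists_realizes_init hΓ
  obtain ⟨K₂, hK₂⟩ := exists_realizes_final hΓ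
  refine ⟨(K₁ + K + K₂) * (2 * c + 1), fun n => (4 * (c * (n + 1)) + 2) * n, ?_, ?_⟩
  · intro a b hab
    dsimp only
    gcongr
  intro l hl hdom hlp
  obtain ⟨L, hL⟩ := exists_length_compList hdom
  set n := l.length with hn
  obtain ⟨m₀, hm₀⟩ := exists_forall_of_mem_list l fun γ hγ => hcK n γ (hl γ hγ)
  set N := c * (n + 1) with hN
  -- Long enough for every factor to be defined in turn and for every simulation to have room.
  obtain ⟨m, hmL, hm⟩ : ∃ m, L ≤ m ∧ m₀ ≤ m := ⟨L + m₀, by omega, by omega⟩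
  obtain ⟨op, hop, S, hS, h⟩ := simulates_compList l (hm₀ m hm) (Nat.le_succ n)
  rw [← hn] at hop hS
  have key : ∀ s, ∃ G : ℕ → Bool,
      op (conf N false N fun p => if p < N then false else s (p - N)) = conf N false N G ∧
      l.prod.1.toFun (bits m s) = some (bits m fun t => G (N + t)) ∧
      ∀ t, N + t ∉ S → G (N + t) = s t := by
    intro s
    have hs : (bits m fun i => if N + i < N then false else s (N + i - N)) = bits m s :=
      bits_congr fun t _ => by rw [if_neg (by omega), Nat.add_sub_cancel_left]
    obtain ⟨y, hy1, hy2⟩ := hL (bits m s) (by simpa using hmL)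
    obtain ⟨a, ℓ, G, h1, -, -, h4, rfl, h6⟩ := h N m
      (fun p => if p < N then false else s (p - N)) y (by omega) (by omega) rfl (by rw [hs, hy1])
    have hlen := hlp _ _ hy2
    rw [length_bits, length_bits] at hlen
    -- Length preservation enters here: the result has length `m` and ends at `N + m`, so its left
    -- end is back at `N`.
    obtain rfl : a = N := by omega
    subst hlen
    refine ⟨G, h1, hy2, fun t ht => ?_⟩
    rw [h6 _ ht, if_neg (by omega), Nat.add_sub_cancel_left]
  constructor
  · rcases Nat.eq_zero_or_pos n with h0 | h0
    · rw [List.length_eq_zero_iff.1 (hn.symm.trans h0), List.prod_nil, wordLength_one]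
      exact Nat.zero_le _
    obtain ⟨b, -, hb, hb'⟩ := ((hK₁ N m).trans hop).trans (hK₂ N m)
    have : b = l.prod := by
      refine M21.eq_of_forall_length m fun x hx => ?_
      obtain ⟨s, rfl⟩ : ∃ s, x = bits m s := ⟨_, by rw [← hx, bits_getD]⟩
      obtain ⟨G, h1, h2, -⟩ := key s
      refine ⟨_, ?_, h2⟩
      rw [hb']
      simp only [h1, conf_tape]
    rw [← this]
    refine hb.trans ?_
    -- This needs `n ≥ 1`, which is why the empty product was treated apart.
    have e1 : N + 1 ≤ (2 * c + 1) * n := by rw [hN]; nlinarith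
    have e2 : K₁ * (N + 1) ≤ K₁ * (N + 1) * n := Nat.le_mul_of_pos_right _ h0
    have e3 : K₂ * (N + 1) ≤ K₂ * (N + 1) * n := Nat.le_mul_of_pos_right _ h0
    calc K₁ * (N + 1) + K * (N + 1) * n + K₂ * (N + 1)
        ≤ (K₁ + K + K₂) * (N + 1) * n := by nlinarith
      _ ≤ (K₁ + K + K₂) * ((2 * c + 1) * n) * n := by gcongr
      _ = _ := by ring
  -- The shift turns tape cells into letter positions; truncation sends padding cells to `0`, which
  -- at worst adds a position to the set.
  · refine ⟨m, S.image (· - N), Finset.card_image_le.trans hS, fun x hx => ?_⟩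
    obtain ⟨G, -, h2, h3⟩ := key fun t => x.getD t false
    rw [← hx, bits_getD, hx] at h2
    refine ⟨_, h2, length_bits _ _, fun i hi => ?_⟩
    by_cases him : i < m
    · rw [getD_bits _ him]
      exact h3 i fun h => hi (Finset.mem_image.2 ⟨_, h, Nat.add_sub_cancel_left _ _⟩)
    · rw [List.getD_eq_default _ _ (by simpa using him), List.getD_eq_default _ _ (by omega)]

end Generators

/-- An injective element of `M_{2,1}` that permutes the words of length `m` and changes only the
letters at positions in `S` has finite order. -/
theorem M21.pow_factorial_eq_one {a : M21}
    (hinj : ∀ x₁ x₂ y : Word, a.1.toFun x₁ = some y → a.1.toFun x₂ = some y → x₁ = x₂)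
    {m : ℕ} {S : Finset ℕ}
    (h : ∀ x : Word, x.length = m → ∃ y : Word, a.1.toFun x = some y ∧ y.length = m ∧
      ∀ i ∉ S, y.getD i false = x.getD i false) {K : ℕ} (hK : 2 ^ S.card ≤ K) :
    a ^ K.factorial = 1 := by
  set f : Word → Word := fun x => (a.1.toFun x).getD [] with hf
  set X : Set Word := {x | x.length = m} with hX
  have h1 : ∀ x ∈ X, f x ∈ X ∧ a.1.toFun x = some (f x) := by
    intro x hx
    obtain ⟨y, hy, hym, -⟩ := h x hx
    simp only [hf, hy, Option.getD_some]
    exact ⟨hym, trivial⟩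
  have hmaps : Set.MapsTo f X X := fun x hx => (h1 x hx).1
  have hfinj : Set.InjOn f X := by
    intro x hx x' hx' hxx
    have e := (h1 x hx).2
    rw [hxx] at e
    exact hinj _ _ _ e (h1 x' hx').2
  have hiter : ∀ k, ∀ x ∈ X, ∀ i ∉ S, (f^[k] x).getD i false = x.getD i false := by
    intro k
    induction k with
    | zero => exact fun _ _ _ _ => rfl
    | succ k ih =>
      intro x hx i hi
      rw [Function.iterate_succ_apply, ih _ (hmaps hx) i hi]
      obtain ⟨y, hy, -, hyS⟩ := h x hx
      simp only [hf, hy, Option.getD_some]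
      exact hyS i hi
  refine M21.eq_of_forall_length m fun x hx => ⟨x, ?_, M21.one_apply x⟩
  rw [M21.pow_apply h1 _ x hx]
  congr 1
  -- Iterates of `x` differ only at positions in `S`, so two of the first `2 ^ S.card + 1` coincide.
  -- Injectivity cancels the common iterations, leaving a period of at most `K`, which divides `K!`.
  obtain ⟨p, q, hpq, hpq'⟩ := Fintype.exists_ne_map_eq_of_card_lt
    (fun (k : Fin (2 ^ S.card + 1)) (i : S) => (f^[k] x).getD i false) (by simp)
  have key : ∀ p q : ℕ, p < q → q ≤ 2 ^ S.card →
      (∀ i ∈ S, (f^[p] x).getD i false = (f^[q] x).getD i false) →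
      f^[K.factorial] x = x := by
    intro p q hpq hq hS
    have e : f^[p] x = f^[q] x := by
      have ep : (f^[p] x).length = m := hmaps.iterate p hx
      have eq : (f^[q] x).length = m := hmaps.iterate q hx
      rw [← bits_getD (f^[p] x), ← bits_getD (f^[q] x), ep, eq]
      refine bits_congr fun t _ => ?_
      by_cases ht : t ∈ S
      · exact hS t ht
      · rw [hiter p x hx t ht, hiter q x hx t ht]
    obtain ⟨j, rfl⟩ := Nat.exists_eq_add_of_lt hpq
    rw [Nat.add_assoc, Function.iterate_add_apply] at e
    have hj : Function.IsPeriodicPt f (j + 1) x :=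
      ((hfinj.iterate hmaps p) hx (hmaps.iterate _ hx) e).symm
    exact hj.trans_dvd (Nat.dvd_factorial (by omega) (by omega))
  rcases lt_or_gt_of_ne (Fin.val_ne_of_ne hpq) with hlt | hlt
  · exact key p q hlt (by omega) fun i hi => congrFun hpq' ⟨i, hi⟩
  · exact key q p hlt (by omega) fun i hi => (congrFun hpq' ⟨i, hi⟩).symm

theorem mem_lepM21_of_mem_lpG21 {u : M21ˣ} (hu : u ∈ lpG21) : (u : M21) ∈ lepM21 :=
  ⟨u.val.1, hu.1.1, fun _ _ _ _ h₁ h₂ h => (hu.2 _ _ h₁).symm.trans (h.trans (hu.2 _ _ h₂)),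
    M21.mk_val _⟩

end Thompson

/-! ### Existence of the maxima and comparison of the asymmetry functions. -/

theorem isGreatest_asymmetry {M : Type*} [Monoid M] {G : Subgroup Mˣ} {Γ : Set M} {n B : ℕ}
    (h : ∀ g ∈ G, wordLength Γ (g : M) ≤ n → wordLength Γ ((g⁻¹ : Mˣ) : M) ≤ B) :
    IsGreatest (asymmetrySet G Γ n) (asymmetry G Γ n) := by
  have hb : BddAbove (asymmetrySet G Γ n) := ⟨B, by
    rintro _ ⟨g, hg, hgn, rfl⟩
    exact h g hg hgn⟩
  refine ⟨Nat.sSup_mem ⟨0, 1, one_mem _, ?_, ?_⟩ hb, fun k hk => le_csSup hb hk⟩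
  · simp [wordLength_one]
  · simp [wordLength_one]

namespace Thompson

/-- The exponent that kills `u` depends only on `n`, through the bound `D n` on the number of
changed positions, so all inverses in question are powers of bounded exponent. Stated for general
`Δ` so as to serve both generating systems. -/
theorem exists_isGreatest_asymmetry {Γ Δ : Set M21}
    (hΓ : Submonoid.closure (Γ ∪ bitTranspositions) = lepM21) (hΔ : Δ.Finite)
    (hΔ' : ∀ u ∈ lpG21, (u : M21) ∈ Submonoid.closure (Δ ∪ bitTranspositions)) :
    (∀ n, IsGreatest (asymmetrySet lpG21 (Δ ∪ bitTranspositions) n)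
      (asymmetry lpG21 (Δ ∪ bitTranspositions) n)) ∧
    ∃ C, ∀ u ∈ lpG21, wordLength (Γ ∪ bitTranspositions) (u : M21) ≤
      C * wordLength (Δ ∪ bitTranspositions) (u : M21) ^ 2 := by
  obtain ⟨C, D, hD, h⟩ := exists_wordLength_le_and_support hΓ hΔ
  constructor
  · intro n
    refine isGreatest_asymmetry (B := (2 ^ D n).factorial * n) fun u hu hun => ?_
    obtain ⟨l, hl, hlu, hln⟩ := exists_list_length_eq_wordLength (hΔ' u hu)
    obtain ⟨-, m, S, hS, hm⟩ := h l hl (by rw [hlu]; exact hu.1.1) (by rw [hlu]; exact hu.2)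
    rw [hlu] at hm
    have hpow := M21.pow_factorial_eq_one hu.1.2.2 hm (K := 2 ^ D n)
      (Nat.pow_le_pow_right (by omega) (hS.trans (hD (by omega))))
    have hinv : ((u⁻¹ : M21ˣ) : M21) = (u : M21) ^ ((2 ^ D n).factorial - 1) := by
      rw [Units.inv_eq_of_mul_eq_one_right]
      rw [← pow_succ', Nat.sub_add_cancel (Nat.factorial_pos _), hpow]
    rw [hinv]
    refine (wordLength_pow_le (hΔ' u hu) _).trans ?_
    exact Nat.mul_le_mul (Nat.sub_le _ _) hun
  · refine ⟨C, fun u hu => ?_⟩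
    obtain ⟨l, hl, hlu, hln⟩ := exists_list_length_eq_wordLength (hΔ' u hu)
    rw [← hln, ← hlu]
    exact (h l hl (by rw [hlu]; exact hu.1.1) (by rw [hlu]; exact hu.2)).1

end Thompson

theorem asymmetry_mono {M : Type*} [Monoid M] {G : Subgroup Mˣ} {Γ : Set M}
    (h : ∀ n, IsGreatest (asymmetrySet G Γ n) (asymmetry G Γ n)) : Monotone (asymmetry G Γ) := by
  intro a b hab
  obtain ⟨g, hg, hga, hg'⟩ := (h a).1
  exact (h b).2 ⟨g, hg, hga.trans hab, hg'⟩

theorem wordLength_inv_le_asymmetry {M : Type*} [Monoid M] {G : Subgroup Mˣ} {Γ : Set M} {n : ℕ}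
    (h : IsGreatest (asymmetrySet G Γ n) (asymmetry G Γ n)) {g : Mˣ} (hg : g ∈ G)
    (hn : wordLength Γ (g : M) ≤ n) : wordLength Γ ((g⁻¹ : Mˣ) : M) ≤ asymmetry G Γ n :=
  h.2 ⟨g, hg, hn, rfl⟩

theorem mainTheorem7
    (Γlep ΓM : Set Thompson.M21) (hlep_fin : Γlep.Finite) (hM_fin : ΓM.Finite)
    (hlep : Submonoid.closure (Γlep ∪ Thompson.bitTranspositions) = Thompson.lepM21)
    (hM : Submonoid.closure ΓM = ⊤) :
    (∀ n : ℕ, IsGreatest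
      (asymmetrySet Thompson.lpG21 (ΓM ∪ Thompson.bitTranspositions) n)
      (asymmetry Thompson.lpG21 (ΓM ∪ Thompson.bitTranspositions) n)) ∧
    (∀ n : ℕ, IsGreatest
      (asymmetrySet Thompson.lpG21 (Γlep ∪ Thompson.bitTranspositions) n)
      (asymmetry Thompson.lpG21 (Γlep ∪ Thompson.bitTranspositions) n)) ∧
    PolyEquiv
      (asymmetry Thompson.lpG21 (ΓM ∪ Thompson.bitTranspositions))
      (asymmetry Thompson.lpG21 (Γlep ∪ Thompson.bitTranspositions)) ∧
    (∃ c₀ c₁ : ℕ, 0 < c₀ ∧ 0 < c₁ ∧ ∀ n : ℕ,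
      asymmetry Thompson.lpG21 (ΓM ∪ Thompson.bitTranspositions) n ≤
        c₀ * asymmetry Thompson.lpG21 (Γlep ∪ Thompson.bitTranspositions) (c₁ * n ^ 2)) ∧
    (∃ c₀' c₁' : ℕ, 0 < c₀' ∧ 0 < c₁' ∧ ∀ n : ℕ,
      asymmetry Thompson.lpG21 (Γlep ∪ Thompson.bitTranspositions) n ≤
        c₀' * asymmetry Thompson.lpG21 (ΓM ∪ Thompson.bitTranspositions) (c₁' * n) ^ 2) := by
  have hM' : Submonoid.closure (ΓM ∪ Thompson.bitTranspositions) = ⊤ :=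
    top_le_iff.1 (hM ▸ Submonoid.closure_mono Set.subset_union_left)
  have mem_M : ∀ u : Thompson.M21, u ∈ Submonoid.closure (ΓM ∪ Thompson.bitTranspositions) :=
    fun u => hM' ▸ Submonoid.mem_top u
  have mem_lep : ∀ u ∈ Thompson.lpG21,
      (u : Thompson.M21) ∈ Submonoid.closure (Γlep ∪ Thompson.bitTranspositions) :=
    fun u hu => hlep ▸ Thompson.mem_lepM21_of_mem_lpG21 hu
  obtain ⟨gM, C, hC⟩ := Thompson.exists_isGreatest_asymmetry hlep hM_fin fun u _ => mem_M u
  obtain ⟨gl, -⟩ := Thompson.exists_isGreatest_asymmetry hlep hlep_fin mem_lep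
  obtain ⟨B, hB0, hB⟩ := exists_wordLength_le_mul (T := Thompson.bitTranspositions) hlep_fin
    fun u _ => mem_M u
  -- The quadratic translation is applied to `g` and the linear one to its inverse; in `h2` the
  -- roles are exchanged, so the square falls outside. `C + 1` replaces `C` to be positive.
  have h1 : ∀ n, asymmetry Thompson.lpG21 (ΓM ∪ Thompson.bitTranspositions) n ≤
      B * asymmetry Thompson.lpG21 (Γlep ∪ Thompson.bitTranspositions) ((C + 1) * n ^ 2) := by
    intro n
    obtain ⟨g, hg, hgn, hg'⟩ := (gM n).1
    rw [← hg']
    refine (hB _ (mem_lep _ (inv_mem hg))).trans (Nat.mul_le_mul_left B ?_)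
    exact wordLength_inv_le_asymmetry (gl _) hg
      ((hC g hg).trans (Nat.mul_le_mul (Nat.le_succ C) (Nat.pow_le_pow_left hgn 2)))
  have h2 : ∀ n, asymmetry Thompson.lpG21 (Γlep ∪ Thompson.bitTranspositions) n ≤
      (C + 1) * asymmetry Thompson.lpG21 (ΓM ∪ Thompson.bitTranspositions) (B * n) ^ 2 := by
    intro n
    obtain ⟨g, hg, hgn, hg'⟩ := (gl n).1
    rw [← hg']
    refine (hC _ (inv_mem hg)).trans
      (Nat.mul_le_mul (Nat.le_succ C) (Nat.pow_le_pow_left ?_ 2))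
    exact wordLength_inv_le_asymmetry (gM _) hg
      ((hB _ (mem_lep g hg)).trans (Nat.mul_le_mul_left B hgn))
  refine ⟨gM, gl, ?_, ⟨B, C + 1, hB0, C.succ_pos, h1⟩, ⟨C + 1, B, C.succ_pos, hB0, h2⟩⟩
  -- A common constant dominates all others; monotonicity and `k ≤ k ^ 2` supply the missing
  -- squares.
  refine ⟨1, B + C + 1, B + C + 1, 2, 2, one_pos, by omega, by omega, two_pos, two_pos,
    fun n _ => ⟨(h1 n).trans ?_, (h2 n).trans ?_⟩⟩
  · refine Nat.mul_le_mul (by omega) ((asymmetry_mono gl ?_).trans (Nat.le_self_pow two_ne_zero _))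
    exact Nat.mul_le_mul_right _ (by omega)
  · refine Nat.mul_le_mul (by omega) (Nat.pow_le_pow_left (asymmetry_mono gM ?_) 2)
    exact Nat.mul_le_mul (by omega) (Nat.le_self_pow two_ne_zero _)
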